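/- Let $q$ be an odd prime power, let $\xi$ be a primitive element of $\mathbb F_{q^2}$, and let $(X_1,X_2,X_3,X_4)$ be homogeneous coordinates of $\mathrm{PG}(3,q^2)$. Put $$\mathcal O=\{(s^{q+1},s^qt,st^q,t^{q+1}) : s,t\in\mathbb F_{q^2},\ (s,t)\neq(0,0)\}\subset \mathrm{PG}(3,q^2).$$ For $j\in\{1,\dots,q\}\setminus\{\frac{q+1}2\}$ let $\mathcal S_j$ be the set of points of $\mathrm{PG}(3,q^2)$ satisfying $$X_1^qX_4+X_1X_4^q-X_2^{q+1}-X_3^{q+1}-\left(\xi^{j\frac{q-1}2}+\xi^{-j\frac{q-1}2}\right)(X_1X_4-X_2X_3)^{\frac{q+1}2}=0,$$ and for $k\in\{1,\dots,q-2\}\setminus\{\frac{q-1}2\}$ let $\mathcal E_k$ be the set of points of $\mathrm{PG}(3,q^2)$ satisfying $$X_1^qX_4+X_1X_4^q-X_2^{q+1}-X_3^{q+1}-\left(\xi^{k\frac{q+1}2}+\xi^{-k\frac{q+1}2}\right)(X_1X_4-X_2X_3)^{\frac{q+1}2}=0.$$ Let $K\le \mathrm{PGL}(4,q^2)$ be the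 group of the projectivities induced by the matrices $A^q\otimes A$, $A\in\mathrm{SL}(2,q^2)$, where $A^q$ is $A$ with all entries raised to the $q$-th power and $\otimes$ is the Kronecker product. Let $\mathcal H_1$ and $\mathcal H_2$ be the $K$-orbits of the points $(\xi^{\frac{q+1}2},0,0,1)$ and $(0,\xi^{\frac{q-1}2},1,0)$, respectively (these are the two $K$-orbits on the points of the Hermitian surface $X_1^qX_4+X_1X_4^q-X_2^{q+1}-X_3^{q+1}=0$ not on $\mathcal O$). Let $\mathcal V_4$ be any of the sets $\mathcal S_j\cup\mathcal E_k$, $\mathcal H_1\cup\mathcal E_k$, $\mathcal S_j\cup\mathcal H_2$, with $j,k$ in the ranges above. Then exactly $(q+1)(q^2+1)$ lines of $\mathrm{PG}(3,q^2)$ are contained in $\mathcal V_4$. Moreover: - no line contained in $\mathcal V_4$ passes through a point of $\mathcal S_j\setminus\mathcal O$ (if $\mathcal V_4=\mathcal S_j\cup\mathcal E_k$ or $\mathcal S_j\cup\mathcal H_2$), respectively of $\mathcal H_1$ (if $\mathcal V_4=\mathcal H_1\cup\mathcal E_k$); - exactly two lines contained in $\mathcal V_4$ pass through each point of $\mathcal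 E_k\setminus\mathcal O$ (if $\mathcal V_4=\mathcal S_j\cup\mathcal E_k$ or $\mathcal H_1\cup\mathcal E_k$), respectively of $\mathcal H_2$ (if $\mathcal V_4=\mathcal S_j\cup\mathcal H_2$); - exactly $q+1$ lines contained in $\mathcal V_4$ pass through each point of $\mathcal O$. -/

import Mathlib

open scoped LinearAlgebra.Projectivization MatrixGroups Kronecker

namespace HermVeronese

variable {F : Type*} [Field F]

/-- The projective space `PG(3, F)`; the homogeneous coordinates `X₁, X₂, X₃, X₄` are the
coordinates with index `0, 1, 2, 3`. -/
abbrev PG3 (F : Type*) [Field F] : Type _ := ℙ F (Fin 4 → F)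

/-- The form `X₁^q X₄ + X₁ X₄^q - X₂^(q+1) - X₃^(q+1) - γ (X₁ X₄ - X₂ X₃)^((q+1)/2)`. -/
def form (q : ℕ) (γ : F) (v : Fin 4 → F) : F :=
  v 0 ^ q * v 3 + v 0 * v 3 ^ q - v 1 ^ (q + 1) - v 2 ^ (q + 1)
    - γ * (v 0 * v 3 - v 1 * v 2) ^ ((q + 1) / 2)

/-- For odd `q` the form is homogeneous of degree `q + 1`. -/
theorem form_smul {q : ℕ} (hodd : Odd q) (γ c : F) (v : Fin 4 → F) :
    form q γ (c • v) = c ^ (q + 1) * form q γ v := by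
  obtain ⟨m, rfl⟩ := hodd
  have h : (2 * m + 1 + 1) / 2 = m + 1 := by omega
  have e : c * v 0 * (c * v 3) - c * v 1 * (c * v 2) = c ^ 2 * (v 0 * v 3 - v 1 * v 2) := by ring
  simp only [form, Pi.smul_apply, smul_eq_mul, h, e, mul_pow]
  ring

/-- The points of `PG(3, F)` at which `form q γ` vanishes. -/
def surface (q : ℕ) (γ : F) : Set (PG3 F) := {P | form q γ P.rep = 0}

/-- For odd `q`, membership in `surface q γ` can be tested on any representative. -/
theorem mk_mem_surface {q : ℕ} (hodd : Odd q) (γ : F) (v : Fin 4 → F) (hv : v ≠ 0) :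
    Projectivization.mk F v hv ∈ surface q γ ↔ form q γ v = 0 := by
  obtain ⟨a, ha⟩ := Projectivization.exists_smul_eq_mk_rep F v hv
  have h : form q γ (Projectivization.mk F v hv).rep = (a : F) ^ (q + 1) * form q γ v := by
    rw [← ha, Units.smul_def, form_smul hodd]
  simp [surface, h]

/-- The surface `S_j`. -/
def S (q : ℕ) (ξ : Fˣ) (j : ℕ) : Set (PG3 F) :=
  surface q (((ξ ^ (j * ((q - 1) / 2)) : Fˣ) : F) + (((ξ ^ (j * ((q - 1) / 2)))⁻¹ : Fˣ) : F))

/-- The surface `E_k`. -/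
def E (q : ℕ) (ξ : Fˣ) (k : ℕ) : Set (PG3 F) :=
  surface q (((ξ ^ (k * ((q + 1) / 2)) : Fˣ) : F) + (((ξ ^ (k * ((q + 1) / 2)))⁻¹ : Fˣ) : F))

/-- The Hermitian Veronese curve `O = {(s^(q+1), s^q t, s t^q, t^(q+1))}`; the vector is nonzero
exactly when `(s, t) ≠ (0, 0)`. -/
def O (F : Type*) [Field F] (q : ℕ) : Set (PG3 F) :=
  {P | ∃ (s t : F) (h : ![s ^ (q + 1), s ^ q * t, s * t ^ q, t ^ (q + 1)] ≠ 0),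
    P = Projectivization.mk F _ h}

/-- In a finite field with `q^2` elements, `q` is a power of the characteristic. -/
theorem exists_charP_pow [Finite F] {q : ℕ} (hq : Nat.card F = q ^ 2) :
    ∃ (p m : ℕ) (_ : Fact p.Prime) (_ : CharP F p), q = p ^ m := by
  have := Fintype.ofFinite F
  obtain ⟨p, hp⟩ := CharP.exists F
  obtain ⟨n, hprime, hcard⟩ := FiniteField.card F p
  rw [Nat.card_eq_fintype_card, hcard] at hq
  obtain ⟨m, -, hm⟩ := (Nat.dvd_prime_pow hprime).1 (hq ▸ dvd_pow_self q two_ne_zero)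
  exact ⟨p, m, ⟨hprime⟩, hp, hm⟩

/-- The map `x ↦ x^q` of a field with `q^2` elements, as a ring homomorphism. -/
def frob [Finite F] {q : ℕ} (hq : Nat.card F = q ^ 2) : F →+* F where
  toFun x := x ^ q
  map_one' := one_pow q
  map_mul' x y := mul_pow x y q
  map_zero' := by
    obtain ⟨p, m, hp, -, rfl⟩ := exists_charP_pow hq
    exact zero_pow (pow_ne_zero m hp.out.ne_zero)
  map_add' x y := by
    obtain ⟨p, m, hp, hF, rfl⟩ := exists_charP_pow hq
    exact add_pow_char_pow x y p m

/-- The matrix `A^q ⊗ A`, where `A^q` has the entries of `A` raised to the `q`-th power. The index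
pairs `(0,0), (0,1), (1,0), (1,1)` are identified with `0, 1, 2, 3`. -/
def twistedSquare [Finite F] {q : ℕ} (hq : Nat.card F = q ^ 2) :
    SL(2, F) →* Matrix (Fin 4) (Fin 4) F where
  toFun A := Matrix.reindex finProdFinEquiv finProdFinEquiv
    ((A : Matrix (Fin 2) (Fin 2) F).map (frob hq) ⊗ₖ (A : Matrix (Fin 2) (Fin 2) F))
  map_one' := by simp
  map_mul' A B := by
    simp [Matrix.map_mul, Matrix.mul_kronecker_mul, Matrix.submatrix_mul_equiv]

/-- The group `K` of the projectivities of `PG(3, F)` induced by the matrices `A^q ⊗ A`,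
`A ∈ SL(2, F)`. -/
def K [Finite F] {q : ℕ} (hq : Nat.card F = q ^ 2) : Subgroup PGL(4, F) :=
  (Matrix.ProjGenLinGroup.mk.comp (twistedSquare hq).toHomUnits).range

/-- The `K`-orbit `H₁`, with representative `(ξ^((q+1)/2), 0, 0, 1)`. -/
def H₁ [Finite F] {q : ℕ} (hq : Nat.card F = q ^ 2) (ξ : Fˣ) : Set (PG3 F) :=
  MulAction.orbit (K hq)
    (Projectivization.mk F ![(ξ : F) ^ ((q + 1) / 2), 0, 0, 1] (by simp) : PG3 F)

/-- The `K`-orbit `H₂`, with representative `(0, ξ^((q-1)/2), 1, 0)`. -/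
def H₂ [Finite F] {q : ℕ} (hq : Nat.card F = q ^ 2) (ξ : Fˣ) : Set (PG3 F) :=
  MulAction.orbit (K hq)
    (Projectivization.mk F ![0, (ξ : F) ^ ((q - 1) / 2), 1, 0] (by simp) : PG3 F)

/-- The lines of `PG(3, F)` all of whose points belong to `V`. -/
def linesIn (V : Set (PG3 F)) : Set (Projectivization.Subspace F (Fin 4 → F)) :=
  {l | Module.finrank F (Projectivization.Subspace.submodule l) = 2 ∧ (l : Set (PG3 F)) ⊆ V}

/-- The lines contained in `V` are `(q+1)(q^2+1)` in number; none of them passes through a point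
of `A`, exactly two pass through each point of `B`, and exactly `q+1` pass through each point
of `C`. -/
def LinePattern (q : ℕ) (V A B C : Set (PG3 F)) : Prop :=
  (linesIn V).ncard = (q + 1) * (q ^ 2 + 1) ∧
  (∀ P ∈ A, ∀ l ∈ linesIn V, P ∉ l) ∧
  (∀ P ∈ B, {l ∈ linesIn V | P ∈ l}.ncard = 2) ∧
  (∀ P ∈ C, {l ∈ linesIn V | P ∈ l}.ncard = q + 1)

end HermVeronese

/-! Read `v` as the 2×2 matrix of a sesquilinear form on F²; `dt` is its determinant, and `A^q ⊗ A`
acts by change of basis, preserving `dt` and `hm`. Off the curve every piece of V lies in a stratum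
`Inv q γ ε` with γ = η + η⁻¹. For γ ≠ 0 conjugating the equation of the surface determines ε. For γ
= 0 it does not, and ε separates H₁ from H₂, which play the roles of the omitted indices j = (q+1)/2
and k = (q-1)/2.

A line in V meets the curve: otherwise a relation α + β hm^(q-1) + δ dt^((q²-1)/2) = 0 with α ≠ 0
would hold along it, which a degree count forbids (`eq_zero_of_forall_line`, `exists_osec_mem`). It
then lies in the tangent plane at its curve point r, since other lines through r contain points on
neither surface (`exists_of_bl_ne_zero`). In that plane adding multiples of r changes neither form,
so a stratum is cut in a cone with vertex r. Its generators correspond to the x with x^((q+1)/2)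
equal to -η or -η⁻¹ and with character ε: none for type S, q+1 for type E. Each line meets the curve
once, so the q²+1 curve points give the total. Finally, tangent planes through X correspond to
isotropic lines of the form X, and type E has exactly two (`TypeE.exists_isotropic`). -/

namespace HermVeronese

/-! ### The two forms and the curve where both vanish. -/

variable {F : Type*} [Field F]

/-- The quadratic form `X₁ X₄ - X₂ X₃`. -/
def dt (v : Fin 4 → F) : F := v 0 * v 3 - v 1 * v 2

/-- The Hermitian form `X₁^q X₄ + X₁ X₄^q - X₂^(q+1) - X₃^(q+1)`. -/
def hm (q : ℕ) (v : Fin 4 → F) : F :=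
  v 0 ^ q * v 3 + v 0 * v 3 ^ q - v 1 ^ (q + 1) - v 2 ^ (q + 1)

/-- The polar form of `dt`. -/
def bl (u v : Fin 4 → F) : F := u 0 * v 3 + u 3 * v 0 - u 1 * v 2 - u 2 * v 1

/-- The parametrization of the Hermitian Veronese curve. -/
def osec (q : ℕ) (s t : F) : Fin 4 → F := ![s ^ (q + 1), s ^ q * t, s * t ^ q, t ^ (q + 1)]

theorem form_eq (q : ℕ) (γ : F) (v : Fin 4 → F) :
    form q γ v = hm q v - γ * dt v ^ ((q + 1) / 2) := rfl

theorem dt_smul (c : F) (v : Fin 4 → F) : dt (c • v) = c ^ 2 * dt v := by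
  simp only [dt, Pi.smul_apply, smul_eq_mul]; ring

theorem hm_smul (q : ℕ) (c : F) (v : Fin 4 → F) : hm q (c • v) = c ^ (q + 1) * hm q v := by
  simp only [hm, Pi.smul_apply, smul_eq_mul]; ring

theorem bl_smul_right (c : F) (u v : Fin 4 → F) : bl u (c • v) = c * bl u v := by
  simp only [bl, Pi.smul_apply, smul_eq_mul]; ring

theorem bl_add_right (u v w : Fin 4 → F) : bl u (v + w) = bl u v + bl u w := by
  simp only [bl, Pi.add_apply]; ring

theorem bl_self (u : Fin 4 → F) : bl u u = 2 * dt u := by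
  simp only [bl, dt]; ring

theorem bl_comm (u v : Fin 4 → F) : bl u v = bl v u := by
  simp only [bl]; ring

theorem dt_add (u v : Fin 4 → F) : dt (u + v) = dt u + bl u v + dt v := by
  simp only [bl, dt, Pi.add_apply]; ring

theorem dt_osec (q : ℕ) (s t : F) : dt (osec q s t) = 0 := by
  simp [dt, osec]; ring

theorem osec_ne_zero {q : ℕ} {s t : F} (h : s ≠ 0 ∨ t ≠ 0) : osec q s t ≠ 0 := by
  intro h0
  have h1 := congrFun h0 0
  have h2 := congrFun h0 3
  simp [osec] at h1 h2
  tauto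

theorem hm_osec (q : ℕ) (s t : F) : hm q (osec q s t) = 0 := by
  simp [hm, osec, mul_pow]; ring

/-- Joining a point `X` to a point of the curve in its tangent plane changes neither form. -/
theorem dt_add_smul_osec {q : ℕ} {s t : F} {X : Fin 4 → F} (h : bl (osec q s t) X = 0) (a : F) :
    dt (X + a • osec q s t) = dt X := by
  rw [dt_add, dt_smul, dt_osec, bl_smul_right, bl_comm, h]; ring

section finite

variable [Finite F] {q : ℕ} (hq : Nat.card F = q ^ 2)

theorem frob_apply (x : F) : frob hq x = x ^ q := rfl

theorem one_lt_of_card (hq : Nat.card F = q ^ 2) : 1 < q := by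
  have : 1 < q ^ 2 := hq ▸ Finite.one_lt_card
  by_contra h
  have : q ^ 2 ≤ 1 ^ 2 := Nat.pow_le_pow_left (not_lt.1 h) 2
  omega

theorem frob_frob (x : F) : frob hq (frob hq x) = x := by
  have := Fintype.ofFinite F
  rw [frob_apply, frob_apply, ← pow_mul, ← sq, ← hq, Nat.card_eq_fintype_card,
    FiniteField.pow_card]

theorem hm_eq (v : Fin 4 → F) : hm q v =
    frob hq (v 0) * v 3 + v 0 * frob hq (v 3) - frob hq (v 1) * v 1 - frob hq (v 2) * v 2 := by
  simp only [hm, frob_apply, pow_succ]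

theorem frob_hm (v : Fin 4 → F) : frob hq (hm q v) = hm q v := by
  simp only [hm_eq hq, map_add, map_sub, map_mul, frob_frob]; ring

theorem osec_eq (s t : F) : osec q s t =
    ![frob hq s * s, frob hq s * t, s * frob hq t, frob hq t * t] := by
  simp only [osec, frob_apply, pow_succ]

theorem card_pow_sub_one (hq : Nat.card F = q ^ 2) {x : F} (hx : x ≠ 0) : x ^ (q ^ 2 - 1) = 1 := by
  have := Fintype.ofFinite F
  rw [← hq, Nat.card_eq_fintype_card, FiniteField.pow_card_sub_one_eq_one x hx]

/-- Converse of `dt_osec` and `hm_osec`: the curve is the whole intersection of the quadric and the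
Hermitian surface. -/
theorem exists_osec (hq : Nat.card F = q ^ 2) {v : Fin 4 → F} (hv : v ≠ 0) (hd : dt v = 0)
    (hh : hm q v = 0) :
    ∃ c s t : F, c ≠ 0 ∧ (s ≠ 0 ∨ t ≠ 0) ∧ v = c • osec q s t := by
  rw [hm_eq hq] at hh
  rw [dt] at hd
  by_cases h0 : v 0 = 0
  · have h12 : v 1 = 0 ∧ v 2 = 0 := by
      simp only [h0, map_zero, zero_mul, zero_sub, zero_add, neg_eq_zero, mul_eq_zero] at hd hh
      rcases hd with h | h
      · refine ⟨h, ?_⟩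
        simpa [h] using hh
      · refine ⟨?_, h⟩
        simpa [h] using hh
    refine ⟨v 3, 0, 1, ?_, Or.inr one_ne_zero, ?_⟩
    · intro h3
      apply hv
      ext i
      fin_cases i <;> simp [h0, h12, h3]
    · have : q ≠ 0 := (zero_lt_one.trans (one_lt_of_card hq)).ne'
      ext i
      fin_cases i <;> simp [h0, h12, osec, this]
  · have hf0 : frob hq (v 0) ≠ 0 := by simpa using h0
    have h2 : v 2 * frob hq (v 0) = v 0 * frob hq (v 1) := by
      have e : frob hq (v 0) * frob hq (v 3) = frob hq (v 1) * frob hq (v 2) := by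
        rw [← map_mul, ← map_mul, sub_eq_zero.1 hd]
      -- The defect has norm zero, hence is zero.
      have h : (v 2 * frob hq (v 0) - v 0 * frob hq (v 1)) *
          frob hq (v 2 * frob hq (v 0) - v 0 * frob hq (v 1)) = 0 := by
        simp only [map_sub, map_mul, frob_frob]
        linear_combination (-(v 0) * frob hq (v 0)) * hh + (v 0) ^ 2 * e
          + (frob hq (v 0)) ^ 2 * hd
      rw [mul_eq_zero, map_eq_zero, or_self] at h
      exact sub_eq_zero.1 h
    refine ⟨v 0, 1, v 1 / v 0, h0, Or.inl one_ne_zero, ?_⟩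
    rw [osec_eq hq]
    ext i
    fin_cases i
    · simp
    · simp; field_simp
    · simp; field_simp; linear_combination h2
    · simp; field_simp
      refine mul_left_cancel₀ h0 ?_
      linear_combination frob hq (v 0) * hd + v 1 * h2

/-- Polarising `hm` at a curve point yields only multiples of `bl (osec q s t) X` and of its
conjugate: quadric and Hermitian surface share their tangent plane there. -/
theorem hm_add_smul_osec (hq : Nat.card F = q ^ 2) {s t : F} {X : Fin 4 → F}
    (h : bl (osec q s t) X = 0) (a : F) :
    hm q (X + a • osec q s t) = hm q X := by
  have h2 := congrArg (frob hq) h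
  rw [osec_eq hq] at *
  simp only [bl, hm_eq hq, map_sub, map_add, map_mul, frob_frob, Pi.add_apply, Pi.smul_apply,
    smul_eq_mul, Matrix.cons_val, map_zero] at *
  linear_combination a * h2 + frob hq a * h

/-- Excludes non-tangent lines: a point with `dt = 0`, `hm ≠ 0` is on no surface, and `dt = 1`, `hm
= 2` would need γ = 2. -/
theorem exists_of_bl_ne_zero (hq : Nat.card F = q ^ 2) {s t : F} {X : Fin 4 → F}
    (h : bl (osec q s t) X ≠ 0) :
    ∃ v ∈ Submodule.span F {osec q s t, X}, v ≠ 0 ∧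
      ((dt v = 0 ∧ hm q v ≠ 0) ∨ (dt v = 1 ∧ hm q v = 2)) := by
  set r := osec q s t with hr
  have hrm : r ∈ Submodule.span F {r, X} := Submodule.subset_span (by simp)
  have hXm : X ∈ Submodule.span F {r, X} := Submodule.subset_span (by simp)
  -- The second intersection of the line with the quadric `dt = 0`.
  set X' := X + (-(dt X / bl r X)) • r with hX'
  have hm' : X' ∈ Submodule.span F {r, X} := add_mem hXm (Submodule.smul_mem _ _ hrm)
  have hb : bl r X' = bl r X := by
    rw [hX', bl_add_right, bl_smul_right, bl_self, hr, dt_osec]; ring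
  have hd : dt X' = 0 := by
    rw [hX', dt_add, dt_smul, bl_smul_right, bl_comm X r, hr, dt_osec, ← hr]
    field_simp; ring
  have h0 : X' ≠ 0 := by
    intro h0
    rw [← hb, h0] at h
    simp [bl] at h
  by_cases hh : hm q X' = 0
  · obtain ⟨c, s', t', hc, -, hX⟩ := exists_osec hq h0 hd hh
    have hr' : osec q s' t' ∈ Submodule.span F {r, X} := by
      have : osec q s' t' = c⁻¹ • X' := by rw [hX, smul_smul, inv_mul_cancel₀ hc, one_smul]
      rw [this]
      exact Submodule.smul_mem _ _ hm'
    have he : bl r (osec q s' t') ≠ 0 := by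
      rw [hX, bl_smul_right] at hb
      exact right_ne_zero_of_mul (hb ▸ h)
    -- Two curve points pair to an element fixed by conjugation, so the scalar e⁻¹ makes `dt` equal
    -- to 1 and `hm` equal to 1 + 1.
    have hfe : frob hq (bl r (osec q s' t')) = bl r (osec q s' t') := by
      rw [hr, osec_eq hq, osec_eq hq]
      simp only [bl, map_sub, map_add, map_mul, frob_frob, Matrix.cons_val]
      ring
    set e := bl r (osec q s' t') with hee
    have hd1 : dt (r + e⁻¹ • osec q s' t') = 1 := by
      rw [dt_add, dt_smul, dt_osec, bl_smul_right, hr, dt_osec, ← hr, ← hee]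
      field_simp; ring
    refine ⟨r + e⁻¹ • osec q s' t', add_mem hrm (Submodule.smul_mem _ _ hr'), ?_,
      Or.inr ⟨hd1, ?_⟩⟩
    · intro h0
      rw [h0] at hd1
      simp [dt] at hd1
    · have key : hm q (r + e⁻¹ • osec q s' t') = e⁻¹ * e + frob hq e⁻¹ * e := by
        rw [hee, hr, osec_eq hq, osec_eq hq]
        simp only [hm_eq hq, bl, map_add, map_mul, frob_frob, Matrix.cons_val,
          Pi.add_apply, Pi.smul_apply, smul_eq_mul]
        ring
      rw [key, map_inv₀, hfe, inv_mul_cancel₀ he]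
      norm_num
  · exact ⟨X', hm', h0, Or.inl ⟨hd, hh⟩⟩

/-! ### The degree argument on lines. -/

open Polynomial in
/-- An affine relation between the two norm-like powers of the forms on all points of a line
has vanishing constant term. -/
theorem eq_zero_of_forall_line (hq : Nat.card F = q ^ 2) (hodd : Odd q) {X Y : Fin 4 → F} {α β δ : F}
    (hX : α + β * hm q X ^ (q - 1) + δ * dt X ^ ((q - 1) * ((q + 1) / 2)) = 0)
    (hY : ∀ t : F, α + β * hm q (Y + t • X) ^ (q - 1)
      + δ * dt (Y + t • X) ^ ((q - 1) * ((q + 1) / 2)) = 0) : α = 0 := by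
  have := Fintype.ofFinite F
  have hq1 := one_lt_of_card hq
  have h2m : 2 * ((q + 1) / 2) = q + 1 := Nat.two_mul_div_two_of_even hodd.add_one
  have hdeg : (q + 1) * (q - 1) = q ^ 2 - 1 := by
    simpa using (Nat.sq_sub_sq q 1).symm
  have hdeg2 : 2 * ((q - 1) * ((q + 1) / 2)) = q ^ 2 - 1 := by
    calc 2 * ((q - 1) * ((q + 1) / 2)) = 2 * ((q + 1) / 2) * (q - 1) := by ring
      _ = _ := by rw [h2m, hdeg]
  have hpos : 1 < q ^ 2 := Nat.one_lt_pow two_ne_zero hq1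
  obtain ⟨a, ha⟩ : ∃ a, a = frob hq (X 0) * Y 3 + Y 0 * frob hq (X 3) - frob hq (X 1) * Y 1
        - frob hq (X 2) * Y 2 := ⟨_, rfl⟩
  obtain ⟨b, hb⟩ : ∃ b, b = frob hq (Y 0) * X 3 + X 0 * frob hq (Y 3) - frob hq (Y 1) * X 1
        - frob hq (Y 2) * X 2 := ⟨_, rfl⟩
  let D : F[X] := C (dt X) * Polynomial.X ^ 2 + C (bl Y X) * Polynomial.X + C (dt Y)
  let H : F[X] := C (hm q X) * Polynomial.X ^ (q + 1)
    + (C a * Polynomial.X ^ q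
      + C b * Polynomial.X + C (hm q Y))
  have hDd : D.natDegree ≤ 2 := natDegree_quadratic_le
  have hDc : D.coeff 2 = dt X := by simp [D]
  have hHd : H.natDegree ≤ q + 1 := by
    simp only [H]
    compute_degree
  have hHc : H.coeff (q + 1) = hm q X := by
    have : q ≠ 0 := by omega
    simp [H, coeff_C, coeff_X_pow, this]
  have hDe (t : F) : D.eval t = dt (Y + t • X) := by
    simp [D, dt_add, dt_smul, bl_smul_right]; ring
  have hHe (t : F) : H.eval t = hm q (Y + t • X) := by
    simp only [H, hm_eq hq, eval_add, eval_mul, eval_C, eval_pow, eval_X, ha, hb, Pi.add_apply,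
      Pi.smul_apply, smul_eq_mul, map_add, map_mul, pow_succ, ← frob_apply hq]
    ring
  -- Degree at most q²-1 and q² zeros force P = 0. Its coefficient in degree q²-1 is the value at
  -- the remaining point X without the constant α.
  let P : F[X] := C α + C β * H ^ (q - 1) + C δ * D ^ ((q - 1) * ((q + 1) / 2))
  have hPd : P.natDegree ≤ q ^ 2 - 1 := by
    refine (natDegree_add_le_of_degree_le (natDegree_add_le_of_degree_le ?_ ?_) ?_)
    · simp
    · exact (natDegree_C_mul_le _ _).trans ((natDegree_pow_le_of_le _ hHd).trans
        (by rw [mul_comm, hdeg]))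
    · exact (natDegree_C_mul_le _ _).trans ((natDegree_pow_le_of_le _ hDd).trans
        (by rw [mul_comm, hdeg2]))
  have hP0 : P = 0 := by
    refine eq_zero_of_natDegree_lt_card_of_eval_eq_zero P Function.injective_id (fun t => ?_) ?_
    · simpa [P, hDe, hHe] using hY t
    · rw [← Nat.card_eq_fintype_card, hq]; omega
  have hc : P.coeff (q ^ 2 - 1) = 0 := by rw [hP0, coeff_zero]
  have hcH := coeff_pow_of_natDegree_le hHd (m := q - 1)
  have hcD := coeff_pow_of_natDegree_le hDd (m := (q - 1) * ((q + 1) / 2))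
  rw [mul_comm (q - 1) (q + 1), hdeg, hHc] at hcH
  rw [mul_comm _ 2, hdeg2, hDc] at hcD
  have hne : q ^ 2 - 1 ≠ 0 := by omega
  simp only [P, coeff_add, coeff_C_mul, coeff_C, if_neg hne, hcH, hcD] at hc
  linear_combination hX - hc

end finite

/-! ### Strata and their sections by tangent planes. -/

/-- The points off the quadric `dt = 0` at which `hm = γ dt ^ ((q+1)/2)` and on which `dt` has
quadratic character `ε`. -/
def Inv (q : ℕ) (γ ε : F) (v : Fin 4 → F) : Prop :=
  dt v ≠ 0 ∧ hm q v = γ * dt v ^ ((q + 1) / 2) ∧ dt v ^ ((q - 1) * ((q + 1) / 2)) = ε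

theorem two_mul_half {q : ℕ} (hodd : Odd q) : 2 * ((q + 1) / 2) = q + 1 :=
  Nat.two_mul_div_two_of_even hodd.add_one

theorem even_sub_one {q : ℕ} (hodd : Odd q) : Even (q - 1) := by
  obtain ⟨n, rfl⟩ := hodd
  simp

theorem pow_half_sq {q : ℕ} (hodd : Odd q) (x : F) : (x ^ ((q + 1) / 2)) ^ 2 = x ^ (q + 1) := by
  rw [← pow_mul, mul_comm, two_mul_half hodd]

theorem sq_pow_half {q : ℕ} (hodd : Odd q) (x : F) : (x ^ 2) ^ ((q + 1) / 2) = x ^ (q + 1) := by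
  rw [← pow_mul, two_mul_half hodd]

theorem Inv.ne_zero {q : ℕ} {γ ε : F} {v : Fin 4 → F} (h : Inv q γ ε v) : v ≠ 0 := by
  rintro rfl
  exact h.1 (by simp [dt])

theorem smul_tangent_vec {b : F} (hb : b ≠ 0) (c d : F) :
    b • ![0, 1, -(-c / b), d / b] = ![0, b, c, d] := by
  ext i
  fin_cases i <;> simp <;> field_simp

/-- Hypotheses on the parameter of a surface meeting each tangent plane of the curve in the point
of contact only. -/
def TypeS (q : ℕ) (η : F) : Prop := (η ^ (q + 1)) ^ 2 = 1 ∧ η ^ 2 ≠ 1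

/-- Hypotheses on the parameter of a surface meeting each tangent plane of the curve in a cone. -/
def TypeE (q : ℕ) (θ : F) : Prop := (θ ^ (q - 1)) ^ 2 = 1 ∧ θ ^ 2 ≠ 1 ∧ θ ≠ 0

theorem TypeS.ne_zero {q : ℕ} {η : F} (h : TypeS q η) : η ≠ 0 := by
  rintro rfl
  simpa using h.1

section finite

variable [Finite F] {q : ℕ}

theorem sq_pow_char (hq : Nat.card F = q ^ 2) (hodd : Odd q) {x : F} (hx : x ≠ 0) :
    (x ^ 2) ^ ((q - 1) * ((q + 1) / 2)) = 1 := by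
  have : (q + 1) * (q - 1) = q ^ 2 - 1 := by simpa using (Nat.sq_sub_sq q 1).symm
  rw [mul_comm, pow_mul, sq_pow_half hodd, ← pow_mul, this, card_pow_sub_one hq hx]

theorem Inv.smul (hq : Nat.card F = q ^ 2) (hodd : Odd q) {γ ε : F} {v : Fin 4 → F}
    (h : Inv q γ ε v) {c : F} (hc : c ≠ 0) : Inv q γ ε (c • v) := by
  obtain ⟨h1, h2, h3⟩ := h
  refine ⟨?_, ?_, ?_⟩
  · rw [dt_smul]
    exact mul_ne_zero (pow_ne_zero _ hc) h1
  · rw [dt_smul, hm_smul, mul_pow, sq_pow_half hodd, h2]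
    ring
  · rw [dt_smul, mul_pow, sq_pow_char hq hodd hc, h3, one_mul]

theorem inv_smul_iff (hq : Nat.card F = q ^ 2) (hodd : Odd q) {γ ε : F} {v : Fin 4 → F}
    {c : F} (hc : c ≠ 0) : Inv q γ ε (c • v) ↔ Inv q γ ε v := by
  refine ⟨fun h => ?_, fun h => h.smul hq hodd hc⟩
  have := h.smul hq hodd (inv_ne_zero hc)
  rwa [smul_smul, inv_mul_cancel₀ hc, one_smul] at this

theorem inv_add_smul_osec (hq : Nat.card F = q ^ 2) {s t γ ε : F} {X : Fin 4 → F}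
    (h : bl (osec q s t) X = 0) (a : F) : Inv q γ ε (X + a • osec q s t) ↔ Inv q γ ε X := by
  rw [Inv, Inv, dt_add_smul_osec h, hm_add_smul_osec hq h]

/-- Coordinates in the tangent plane of the curve at a point. -/
theorem exists_tangent_coords (hq : Nat.card F = q ^ 2) {s t : F} (hst : s ≠ 0 ∨ t ≠ 0) :
    ∃ μ ν : F, (∀ b c, bl (osec q s t) (![0, b, c, μ * b + ν * c] : Fin 4 → F) = 0) ∧
      (∀ X, bl (osec q s t) X = 0 → ∃ a b c : F,
        X = (![0, b, c, μ * b + ν * c] : Fin 4 → F) + a • osec q s t) ∧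
      (∀ a b c : F, (![0, b, c, μ * b + ν * c] : Fin 4 → F) + a • osec q s t = 0 →
         a = 0 ∧ b = 0 ∧ c = 0) := by
  have hq0 : q ≠ 0 := (zero_lt_one.trans (one_lt_of_card hq)).ne'
  by_cases hs : s = 0
  · have ht : t ≠ 0 := by tauto
    subst hs
    -- Here the curve point is a multiple of (0,0,0,1). In both cases the complement of the curve
    -- point has first coordinate 0, so μ and ν do not affect `dt` and `hm`.
    refine ⟨0, 0, ?_, ?_, ?_⟩
    · intro b c
      simp [bl, osec, hq0]
    · intro X hX
      refine ⟨X 3 / t ^ (q + 1), X 1, X 2, ?_⟩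
      have h0 : X 0 = 0 := by simpa [bl, osec, hq0, ht] using hX
      ext i
      fin_cases i <;> simp [osec, hq0, h0, ht]
    · intro a b c h
      have h1 := congrFun h 1
      have h2 := congrFun h 2
      have h3 := congrFun h 3
      simp [osec, hq0, ht] at h1 h2 h3
      exact ⟨h3, h1, h2⟩
  · refine ⟨t ^ q / s ^ q, t / s, ?_, ?_, ?_⟩
    · intro b c
      simp [bl, osec]
      field_simp
      ring
    · intro X hX
      refine ⟨X 0 / s ^ (q + 1), X 1 - X 0 / s ^ (q + 1) * (s ^ q * t),
        X 2 - X 0 / s ^ (q + 1) * (s * t ^ q), ?_⟩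
      simp [bl, osec] at hX
      ext i
      fin_cases i
      · simp [osec, hs]
      · simp [osec]
      · simp [osec]
      · simp [osec]
        field_simp
        linear_combination s * s ^ q * hX
    · intro a b c h
      have h0 := congrFun h 0
      have h1 := congrFun h 1
      have h2 := congrFun h 2
      simp [osec, hs] at h0
      subst h0
      simp at h1 h2
      exact ⟨rfl, h1, h2⟩

/-- With y = x^((q+1)/2) one has `dt` = x and `hm` = -1 - y², and the equation factors as (y + η)(y
+ η⁻¹) = 0. -/
theorem inv_tangent_iff (hq : Nat.card F = q ^ 2) (hodd : Odd q) {η : F} (hη : η ≠ 0) (ε x d : F) :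
    Inv q (η + η⁻¹) ε ![0, 1, -x, d] ↔
      x ≠ 0 ∧ (x ^ ((q + 1) / 2) = -η ∨ x ^ ((q + 1) / 2) = -η⁻¹) ∧
        (x ^ ((q + 1) / 2)) ^ (q - 1) = ε := by
  have hq0 : q ≠ 0 := (zero_lt_one.trans (one_lt_of_card hq)).ne'
  have hd : dt ![0, 1, -x, d] = x := by simp [dt]
  have hh : hm q ![0, 1, -x, d] = -1 - (x ^ ((q + 1) / 2)) ^ 2 := by
    rw [pow_half_sq hodd]
    simp [hm, hq0, hodd.add_one.neg_pow]
  have hp : x ^ ((q - 1) * ((q + 1) / 2)) = (x ^ ((q + 1) / 2)) ^ (q - 1) := by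
    rw [← pow_mul, mul_comm]
  rw [Inv, hd, hh, hp]
  refine and_congr_right fun hx => and_congr_left fun _ => ?_
  rw [← sub_eq_zero, ← neg_eq_zero, ← add_eq_zero_iff_eq_neg, ← add_eq_zero_iff_eq_neg,
    ← mul_eq_zero]
  have : (x ^ ((q + 1) / 2) + η) * (x ^ ((q + 1) / 2) + η⁻¹) =
      -(-1 - (x ^ ((q + 1) / 2)) ^ 2 - (η + η⁻¹) * x ^ ((q + 1) / 2)) := by
    field_simp
    ring
  rw [this]

/-- The roots -η, -η⁻¹ have (q-1)-th power η^(±(q-1)); equality with η^(q+1), whose square is 1,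
would give η² = 1. -/
theorem TypeS.not_inv_tangent (hq : Nat.card F = q ^ 2) (hodd : Odd q) {η : F} (h : TypeS q η)
    (x d : F) : ¬ Inv q (η + η⁻¹) (η ^ (q + 1)) ![0, 1, -x, d] := by
  rw [inv_tangent_iff hq hodd h.ne_zero]
  rintro ⟨-, hx, h2⟩
  have hη := h.ne_zero
  have e : η ^ (q + 1) = η ^ (q - 1) * η ^ 2 := by
    rw [← pow_add]
    congr 1
    have := one_lt_of_card hq
    omega
  rcases hx with hx | hx
  · rw [hx, (even_sub_one hodd).neg_pow, e] at h2
    exact h.2 (mul_left_cancel₀ (pow_ne_zero _ hη) (by rw [← h2, mul_one]))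
  · rw [hx, (even_sub_one hodd).neg_pow, inv_pow] at h2
    have h1 := h.1
    rw [sq] at h1
    nth_rw 1 [← h2] at h1
    rw [e, inv_mul_cancel_left₀ (pow_ne_zero _ hη)] at h1
    exact h.2 h1

/-- The character condition is now automatic: θ^(q-1) is its own inverse. -/
theorem TypeE.inv_tangent_iff (hq : Nat.card F = q ^ 2) (hodd : Odd q) {θ : F} (h : TypeE q θ)
    (x d : F) : Inv q (θ + θ⁻¹) (θ ^ (q - 1)) ![0, 1, -x, d] ↔
      x ^ ((q + 1) / 2) = -θ ∨ x ^ ((q + 1) / 2) = -θ⁻¹ := by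
  rw [HermVeronese.inv_tangent_iff hq hodd h.2.2]
  have hθ := h.2.2
  have hm : (q + 1) / 2 ≠ 0 := by have := two_mul_half hodd; omega
  refine ⟨fun h => h.2.1, fun hx => ⟨?_, hx, ?_⟩⟩
  · rintro rfl
    rw [zero_pow hm] at hx
    rcases hx with hx | hx <;> simp [eq_comm, hθ] at hx
  · rcases hx with hx | hx
    · rw [hx, (even_sub_one hodd).neg_pow]
    · rw [hx, (even_sub_one hodd).neg_pow, inv_pow]
      refine inv_eq_of_mul_eq_one_left ?_
      rw [← sq, h.1]

/-- No point of a surface of type `S` off the curve lies in a tangent plane. -/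
theorem TypeS.not_inv (hq : Nat.card F = q ^ 2) (hodd : Odd q) {η : F} (h : TypeS q η)
    {s t : F} (hst : s ≠ 0 ∨ t ≠ 0) {X : Fin 4 → F} (hX : bl (osec q s t) X = 0) :
    ¬ Inv q (η + η⁻¹) (η ^ (q + 1)) X := by
  intro hi
  obtain ⟨μ, ν, h1, h2, -⟩ := exists_tangent_coords hq hst
  obtain ⟨a, b, c, rfl⟩ := h2 X hX
  rw [inv_add_smul_osec hq (h1 b c)] at hi
  have hb : b ≠ 0 := by
    rintro rfl
    exact hi.1 (by simp [dt])
  rw [← smul_tangent_vec hb, inv_smul_iff hq hodd hb] at hi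
  exact h.not_inv_tangent hq hodd _ _ hi

theorem mem_span_osec (hq : Nat.card F = q ^ 2)
    {s t : F} (hst : s ≠ 0 ∨ t ≠ 0) {X : Fin 4 → F} (hX : bl (osec q s t) X = 0)
    (hd : dt X = 0) (hh : hm q X = 0) : ∃ a : F, X = a • osec q s t := by
  have hq0 : q ≠ 0 := (zero_lt_one.trans (one_lt_of_card hq)).ne'
  obtain ⟨μ, ν, h1, h2, -⟩ := exists_tangent_coords hq hst
  obtain ⟨a, b, c, rfl⟩ := h2 X hX
  rw [dt_add_smul_osec (h1 b c)] at hd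
  rw [hm_add_smul_osec hq (h1 b c)] at hh
  refine ⟨a, ?_⟩
  simp [dt] at hd
  simp [hm, hq0] at hh
  have : b = 0 ∧ c = 0 := by
    rcases hd with rfl | rfl <;> simpa using hh
  rw [this.1, this.2]
  ext i
  fin_cases i <;> simp

end finite

/-! ### Isotropic vectors of the sesquilinear form of a point. -/

/-- The sesquilinear form on `F²` whose matrix has the entries `X₁, X₂, X₃, X₄`. -/
def sesq (q : ℕ) (v : Fin 4 → F) (x y x' y' : F) : F :=
  x ^ q * (v 0 * x' + v 1 * y') + y ^ q * (v 2 * x' + v 3 * y')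

/-- Translates tangency into isotropy: the contact point (s, t) corresponds to the vector (t, -s).
-/
theorem bl_osec (q : ℕ) (hodd : Odd q) (s t : F) (v : Fin 4 → F) :
    bl (osec q s t) v = sesq q v t (-s) t (-s) := by
  simp [bl, osec, sesq, hodd.neg_pow]
  ring

theorem exists_kernel_pair {a b c d : F} (h : a * d = b * c) :
    ∃ x y : F, (x ≠ 0 ∨ y ≠ 0) ∧ a * x + b * y = 0 ∧ c * x + d * y = 0 := by
  by_cases hab : a = 0 ∧ b = 0
  · by_cases hcd : c = 0 ∧ d = 0
    · exact ⟨1, 0, by simp, by simp [hab], by simp [hcd]⟩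
    · refine ⟨d, -c, ?_, by simp [hab], by ring⟩
      rw [neg_ne_zero]
      tauto
  · refine ⟨b, -a, ?_, by ring, by linear_combination -h⟩
    rw [neg_ne_zero]
    tauto

theorem exists_pair_smul {x y x' y' : F} (h : x ≠ 0 ∨ y ≠ 0) (hd : x * y' = x' * y) :
    ∃ c, x' = c * x ∧ y' = c * y := by
  rcases h with h | h
  · exact ⟨x' / x, by field_simp, by field_simp; linear_combination hd⟩
  · exact ⟨y' / y, by field_simp; linear_combination -hd, by field_simp⟩

section finite

variable [Finite F] {q : ℕ}

theorem sesq_eq (hq : Nat.card F = q ^ 2) (v : Fin 4 → F) (x y x' y' : F) : sesq q v x y x' y' =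
    frob hq x * (v 0 * x' + v 1 * y') + frob hq y * (v 2 * x' + v 3 * y') := rfl

/-- The hypotheses say M*u = ρMu, where M is the matrix of v, M* its conjugate transpose and u = (x,
y). -/
theorem frob_sesq (hq : Nat.card F = q ^ 2) {v : Fin 4 → F} {ρ x y : F}
    (h1 : frob hq (v 0) * x + frob hq (v 2) * y = ρ * (v 0 * x + v 1 * y))
    (h2 : frob hq (v 1) * x + frob hq (v 3) * y = ρ * (v 2 * x + v 3 * y)) (x' y' : F) :
    frob hq (sesq q v x y x' y') = ρ * sesq q v x' y' x y := by
  rw [sesq_eq hq, sesq_eq hq]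
  simp only [map_add, map_mul, frob_frob]
  linear_combination frob hq x' * h1 + frob hq y' * h2

theorem eq_zero_of_frob_eq (hq : Nat.card F = q ^ 2) {z ρ : F} (hρ : frob hq ρ * ρ ≠ 1)
    (h : frob hq z = ρ * z) : z = 0 := by
  have h2 := congrArg (frob hq) h
  rw [map_mul, frob_frob, h] at h2
  by_contra hz
  exact hρ (mul_right_cancel₀ hz (by linear_combination -h2))

/-- The assumed quadratic in ρ is det(M* - ρM). -/
theorem exists_eigenvector (hq : Nat.card F = q ^ 2) {v : Fin 4 → F} {ρ : F}
    (h : dt v * ρ ^ 2 - hm q v * ρ + frob hq (dt v) = 0) :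
    ∃ x y : F, (x ≠ 0 ∨ y ≠ 0) ∧
      frob hq (v 0) * x + frob hq (v 2) * y = ρ * (v 0 * x + v 1 * y) ∧
      frob hq (v 1) * x + frob hq (v 3) * y = ρ * (v 2 * x + v 3 * y) := by
  obtain ⟨x, y, h0, h1, h2⟩ := exists_kernel_pair (a := frob hq (v 0) - ρ * v 0)
    (b := frob hq (v 2) - ρ * v 1) (c := frob hq (v 1) - ρ * v 2) (d := frob hq (v 3) - ρ * v 3)
    (by
      rw [hm_eq hq] at h
      simp only [dt, map_sub, map_mul] at h
      linear_combination h)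
  exact ⟨x, y, h0, by linear_combination h1, by linear_combination h2⟩

/-- At a point of a surface of type `E` the sesquilinear form has exactly two isotropic lines. -/
theorem TypeE.exists_isotropic (hq : Nat.card F = q ^ 2) (hodd : Odd q) {θ : F} (h : TypeE q θ)
    {v : Fin 4 → F} (hv : Inv q (θ + θ⁻¹) (θ ^ (q - 1)) v) :
    ∃ x₁ y₁ x₂ y₂ : F, x₁ * y₂ - x₂ * y₁ ≠ 0 ∧ sesq q v x₁ y₁ x₁ y₁ = 0 ∧
      sesq q v x₂ y₂ x₂ y₂ = 0 ∧ sesq q v x₂ y₂ x₁ y₁ ≠ 0 ∧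
      ∀ x y, sesq q v x y x y = 0 →
        (∃ c, x = c * x₁ ∧ y = c * y₁) ∨ (∃ c, x = c * x₂ ∧ y = c * y₂) := by
  obtain ⟨hε, hθ2, hθ⟩ := h
  obtain ⟨hd, hh, hc⟩ := hv
  obtain ⟨n, hn⟩ := hodd
  have e1 : (q + 1) / 2 = n + 1 := by omega
  have e2 : q - 1 = 2 * n := by omega
  rw [e1] at hh
  rw [e1, e2] at hc
  rw [e2] at hε
  set d := dt v with hdd
  have hδ : d ^ n ≠ 0 := pow_ne_zero _ hd
  have hfd : frob hq d = d * (d ^ n) ^ 2 := by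
    rw [frob_apply, hn]; ring
  have hfδ : frob hq (d ^ n) * d ^ n = θ ^ (2 * n) := by
    rw [map_pow, hfd, ← hc]; ring
  have hfθ : frob hq θ = θ ^ (2 * n) * θ := by
    rw [frob_apply, hn]; ring
  have hN1 : frob hq (θ * d ^ n) * (θ * d ^ n) = θ ^ 2 := by
    rw [map_mul, hfθ]
    linear_combination θ ^ (2 * n) * θ ^ 2 * hfδ + θ ^ 2 * hε
  have hN2 : frob hq (θ⁻¹ * d ^ n) * (θ⁻¹ * d ^ n) = (θ ^ 2)⁻¹ := by
    rw [map_mul, map_inv₀, hfθ]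
    have := pow_ne_zero (2 * n) hθ
    field_simp
    linear_combination hfδ
  have hi2 : (θ ^ 2)⁻¹ ≠ 1 := by simpa using hθ2
  have hρ : θ * d ^ n ≠ θ⁻¹ * d ^ n := by
    intro h
    have := mul_right_cancel₀ hδ h
    apply hθ2
    field_simp at this
    exact this
  -- Since `hm` = (θ + θ⁻¹)d^(n+1) and d^q = d·d^(2n), the roots are θdⁿ and θ⁻¹dⁿ. Their norms
  -- θ^(±2) differ from 1, which makes both eigenvectors isotropic.
  obtain ⟨x₁, y₁, h10, h11, h12⟩ := exists_eigenvector hq (v := v) (ρ := θ * d ^ n) (by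
    rw [← hdd, hfd, hh]; field_simp; ring)
  obtain ⟨x₂, y₂, h20, h21, h22⟩ := exists_eigenvector hq (v := v) (ρ := θ⁻¹ * d ^ n) (by
    rw [← hdd, hfd, hh]; field_simp; ring)
  have hz1 : sesq q v x₁ y₁ x₁ y₁ = 0 :=
    eq_zero_of_frob_eq hq (by rwa [hN1]) (frob_sesq hq h11 h12 x₁ y₁)
  have hz2 : sesq q v x₂ y₂ x₂ y₂ = 0 :=
    eq_zero_of_frob_eq hq (by rwa [hN2]) (frob_sesq hq h21 h22 x₂ y₂)
  -- A common eigenvector for two distinct eigenvalues would be killed by M.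
  have hind : x₁ * y₂ - x₂ * y₁ ≠ 0 := by
    intro h0
    obtain ⟨c, rfl, rfl⟩ := exists_pair_smul h10 (sub_eq_zero.1 h0)
    have hc : c ≠ 0 := by
      rintro rfl
      simp at h20
    have hu1 : v 0 * x₁ + v 1 * y₁ = 0 := by
      refine (mul_eq_zero.1 (?_ : (θ * d ^ n - θ⁻¹ * d ^ n) * _ = 0)).resolve_left
        (sub_ne_zero.2 hρ)
      refine mul_left_cancel₀ hc ?_
      linear_combination h21 - c * h11
    have hu2 : v 2 * x₁ + v 3 * y₁ = 0 := by
      refine (mul_eq_zero.1 (?_ : (θ * d ^ n - θ⁻¹ * d ^ n) * _ = 0)).resolve_left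
        (sub_ne_zero.2 hρ)
      refine mul_left_cancel₀ hc ?_
      linear_combination h22 - c * h12
    rcases h10 with h | h
    · exact mul_ne_zero hd h (by rw [hdd, dt]; linear_combination v 3 * hu1 - v 1 * hu2)
    · exact mul_ne_zero hd h (by rw [hdd, dt]; linear_combination v 0 * hu2 - v 2 * hu1)
  -- Otherwise the second vector would annihilate a basis, against `dt v ≠ 0`.
  have hp : sesq q v x₂ y₂ x₁ y₁ ≠ 0 := by
    intro h0
    rw [sesq_eq hq] at h0 hz2
    have hu1 : frob hq x₂ * v 0 + frob hq y₂ * v 2 = 0 := by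
      refine (mul_eq_zero.1 (?_ : (x₁ * y₂ - x₂ * y₁) * _ = 0)).resolve_left hind
      linear_combination y₂ * h0 - y₁ * hz2
    have hu2 : frob hq x₂ * v 1 + frob hq y₂ * v 3 = 0 := by
      refine (mul_eq_zero.1 (?_ : (x₁ * y₂ - x₂ * y₁) * _ = 0)).resolve_left hind
      linear_combination x₁ * hz2 - x₂ * h0
    rcases h20 with h | h
    · refine mul_ne_zero hd ((map_ne_zero (frob hq)).2 h) ?_
      rw [hdd, dt]; linear_combination v 3 * hu1 - v 2 * hu2
    · refine mul_ne_zero hd ((map_ne_zero (frob hq)).2 h) ?_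
      rw [hdd, dt]; linear_combination v 0 * hu2 - v 1 * hu1
  refine ⟨x₁, y₁, x₂, y₂, hind, hz1, hz2, hp, fun x y hxy => ?_⟩
  obtain ⟨α, β, hx, hy⟩ : ∃ α β, x = α * x₁ + β * x₂ ∧ y = α * y₁ + β * y₂ := by
    refine ⟨(x * y₂ - x₂ * y) / (x₁ * y₂ - x₂ * y₁), (x₁ * y - x * y₁) / (x₁ * y₂ - x₂ * y₁),
      ?_, ?_⟩ <;>
    rw [div_mul_eq_mul_div, div_mul_eq_mul_div, ← add_div, eq_div_iff hind] <;> ring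
  have hexp : frob hq α * β * sesq q v x₁ y₁ x₂ y₂ + α * frob hq β * sesq q v x₂ y₂ x₁ y₁ = 0 := by
    rw [← hxy, hx, hy]
    rw [sesq_eq hq] at hz1 hz2
    simp only [sesq_eq hq, map_add, map_mul]
    linear_combination -frob hq α * α * hz1 - frob hq β * β * hz2
  have hfp := frob_sesq hq h21 h22 x₁ y₁
  -- The two cross terms cancel, so conjugation multiplies this one by -θ⁻¹dⁿ, whose norm is not 1.
  have hz : α * frob hq β * sesq q v x₂ y₂ x₁ y₁ = 0 := by
    refine eq_zero_of_frob_eq hq (ρ := -(θ⁻¹ * d ^ n)) (by rwa [map_neg, neg_mul_neg, hN2]) ?_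
    rw [map_mul, map_mul, frob_frob, hfp]
    linear_combination (θ⁻¹ * d ^ n) * hexp
  rw [mul_eq_zero, mul_eq_zero, map_eq_zero] at hz
  rcases hz with (rfl | rfl) | hz
  · exact Or.inr ⟨β, by simpa using hx, by simpa using hy⟩
  · exact Or.inl ⟨α, by simpa using hx, by simpa using hy⟩
  · exact absurd hz hp

end finite

/-! ### Lines as planes of F⁴, and the count of tangent lines. -/

theorem exists_mem_not_mem_span {V : Type*} [AddCommGroup V] [Module F V] {W : Submodule F V}
    (hW : Module.finrank F W = 2) (r : V) : ∃ X ∈ W, ∀ a : F, X ≠ a • r := by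
  by_contra! h
  have hle : W ≤ Submodule.span F {r} := fun X hX => by
    obtain ⟨a, rfl⟩ := h X hX
    exact Submodule.smul_mem _ _ (Submodule.mem_span_singleton_self r)
  have h1 := Submodule.finrank_mono hle
  have h2 := finrank_span_le_card (R := F) ({r} : Set V)
  rw [Set.toFinset_singleton, Finset.card_singleton] at h2
  omega

theorem finrank_span_pair {V : Type*} [AddCommGroup V] [Module F V] {r X : V} (hr : r ≠ 0)
    (hX : ∀ a : F, X ≠ a • r) : Module.finrank F (Submodule.span F {r, X}) = 2 := by
  have h : LinearIndependent F ![r, X] :=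
    (LinearIndependent.pair_iff' hr).2 fun a h => hX a h.symm
  have := finrank_span_eq_card h
  rwa [Matrix.range_cons_cons_empty, Fintype.card_fin] at this

theorem span_pair_eq {V : Type*} [AddCommGroup V] [Module F V] {W : Submodule F V}
    (hW : Module.finrank F W = 2) {r X : V} (hr : r ≠ 0) (hrW : r ∈ W) (hXW : X ∈ W)
    (hX : ∀ a : F, X ≠ a • r) : Submodule.span F {r, X} = W := by
  have : FiniteDimensional F W := Module.finite_of_finrank_pos (by omega)
  refine Submodule.eq_of_le_of_finrank_eq ?_ ((finrank_span_pair hr hX).trans hW.symm)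
  rw [Submodule.span_le]
  rintro x (rfl | rfl) <;> assumption

theorem osec_smul_eq (q : ℕ) (c s t : F) : osec q (c * s) (c * t) = c ^ (q + 1) • osec q s t := by
  ext i
  fin_cases i <;> simp [osec, mul_pow] <;> ring

theorem cross_eq_of_osec_eq {q : ℕ} {s t s' t' a : F} (h' : s' ≠ 0 ∨ t' ≠ 0)
    (h : osec q s' t' = a • osec q s t) : s' * t = s * t' := by
  have hne : a • osec q s t ≠ 0 := h ▸ osec_ne_zero h'
  have ha : a ≠ 0 := left_ne_zero_of_smul hne
  have h0 := congrFun h 0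
  have h1 := congrFun h 1
  have h2 := congrFun h 2
  have h3 := congrFun h 3
  simp [osec] at h0 h1 h2 h3
  by_cases hs : s = 0
  · have ht : t ≠ 0 := by
      rintro rfl
      exact hne (by subst hs; ext i; fin_cases i <;> simp [osec])
    have e : a * t ^ q * (s' * t - s * t') = 0 := by
      linear_combination -s' * h3 + t' * h2
    rw [mul_eq_zero, mul_eq_zero] at e
    exact sub_eq_zero.1 (e.resolve_left (by simp [ha, ht]))
  · have e : a * s ^ q * (s' * t - s * t') = 0 := by
      linear_combination t' * h0 - s' * h1
    rw [mul_eq_zero, mul_eq_zero] at e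
    exact sub_eq_zero.1 (e.resolve_left (by simp [ha, hs]))

theorem Inv.hm_ne_zero {q : ℕ} {γ ε : F} {v : Fin 4 → F} (h : Inv q γ ε v) (hγ : γ ≠ 0) :
    hm q v ≠ 0 := by
  rw [h.2.1]
  exact mul_ne_zero hγ (pow_ne_zero _ h.1)

/-- Lines through a point of the curve all of whose other points lie on the surface of type `E`
with parameter `θ`. -/
def TangentLine (q : ℕ) (θ s t : F) (W : Submodule F (Fin 4 → F)) : Prop :=
  Module.finrank F W = 2 ∧ osec q s t ∈ W ∧ ∀ X ∈ W, bl (osec q s t) X = 0 ∧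
    ((∃ a : F, X = a • osec q s t) ∨ Inv q (θ + θ⁻¹) (θ ^ (q - 1)) X)

theorem add_inv_ne_two {η : F} (h0 : η ≠ 0) (h : η ^ 2 ≠ 1) : η + η⁻¹ ≠ 2 := by
  intro h2
  field_simp at h2
  have : (η - 1) ^ 2 = 0 := by linear_combination h2
  rw [sq_eq_zero_iff, sub_eq_zero] at this
  exact h (by rw [this, one_pow])

theorem TangentLine.cross_eq {q : ℕ} {θ s t s' t' : F} {W : Submodule F (Fin 4 → F)}
    (h : TangentLine q θ s t W) (hst' : s' ≠ 0 ∨ t' ≠ 0) (hm : osec q s' t' ∈ W) :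
    s' * t = s * t' := by
  rcases (h.2.2 _ hm).2 with ⟨a, ha⟩ | hi
  · exact cross_eq_of_osec_eq hst' ha
  · exact absurd (dt_osec q s' t') hi.1

section finite

variable [Finite F] {q : ℕ}

theorem hm_pow_sub_one (hq : Nat.card F = q ^ 2) {v : Fin 4 → F} (h : hm q v ≠ 0) :
    hm q v ^ (q - 1) = 1 := by
  have h1 := frob_hm hq v
  rw [frob_apply] at h1
  have h2 := one_lt_of_card hq
  refine mul_right_cancel₀ h ?_
  rw [← pow_succ, Nat.sub_add_cancel h2.le, h1, one_mul]

/-- Every line in the union of two surfaces (with different parameters, one of them nonzero)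
meets the curve. -/
theorem exists_osec_mem (hq : Nat.card F = q ^ 2) (hodd : Odd q) {γ γ' ε ε' : F} (hε : ε ≠ 0)
    (hε' : ε' ≠ 0) (hγ : γ ≠ 0 ∨ γ' ≠ 0) {W : Submodule F (Fin 4 → F)}
    (hW : Module.finrank F W = 2)
    (hgood : ∀ v ∈ W, v ≠ 0 → (dt v = 0 ∧ hm q v = 0) ∨ Inv q γ ε v ∨ Inv q γ' ε' v) :
    ∃ s t : F, (s ≠ 0 ∨ t ≠ 0) ∧ osec q s t ∈ W := by
  by_contra! hno
  have hgood' : ∀ v ∈ W, v ≠ 0 → Inv q γ ε v ∨ Inv q γ' ε' v := by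
    intro v hv h0
    refine (hgood v hv h0).resolve_left ?_
    rintro ⟨h1, h2⟩
    obtain ⟨c, s, t, hc, hst, rfl⟩ := exists_osec hq h0 h1 h2
    exact hno s t hst ((Submodule.smul_mem_iff _ hc).1 hv)
  have hq1 : q - 1 ≠ 0 := by have := one_lt_of_card hq; omega
  -- `hm^(q-1)` is 1 on a stratum with γ ≠ 0 and 0 on one with γ = 0. If both parameters are nonzero
  -- it is constantly 1; otherwise it tells the strata apart and the character of `dt` is affine in
  -- it.
  obtain ⟨α, β, δ, hα, hrel⟩ : ∃ α β δ : F, α ≠ 0 ∧ ∀ v : Fin 4 → F,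
      Inv q γ ε v ∨ Inv q γ' ε' v →
        α + β * hm q v ^ (q - 1) + δ * dt v ^ ((q - 1) * ((q + 1) / 2)) = 0 := by
    by_cases h0 : γ = 0
    · have h1 : γ' ≠ 0 := by tauto
      refine ⟨ε, ε' - ε, -1, hε, ?_⟩
      rintro v (h | h)
      · have hz : hm q v = 0 := by rw [h.2.1, h0, zero_mul]
        rw [hz, zero_pow hq1, h.2.2]; ring
      · rw [hm_pow_sub_one hq (h.hm_ne_zero h1), h.2.2]; ring
    · by_cases h1 : γ' = 0
      · refine ⟨ε', ε - ε', -1, hε', ?_⟩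
        rintro v (h | h)
        · rw [hm_pow_sub_one hq (h.hm_ne_zero h0), h.2.2]; ring
        · have hz : hm q v = 0 := by rw [h.2.1, h1, zero_mul]
          rw [hz, zero_pow hq1, h.2.2]; ring
      · refine ⟨-1, 1, 0, by simp, ?_⟩
        rintro v (h | h)
        · rw [hm_pow_sub_one hq (h.hm_ne_zero h0)]; ring
        · rw [hm_pow_sub_one hq (h.hm_ne_zero h1)]; ring
  obtain ⟨X, hXW, hX⟩ := exists_mem_not_mem_span hW 0
  obtain ⟨Y, hYW, hY⟩ := exists_mem_not_mem_span hW X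
  have hX0 : X ≠ 0 := by simpa using hX 0
  refine hα (eq_zero_of_forall_line hq hodd (X := X) (Y := Y) (hrel X (hgood' X hXW hX0))
    fun t => hrel _ (hgood' _ (add_mem hYW (Submodule.smul_mem _ t hXW)) fun h => ?_))
  exact hY (-t) (by rw [neg_smul]; exact eq_neg_of_add_eq_zero_left h)

theorem tangentLine_of_mem (hq : Nat.card F = q ^ 2) (hodd : Odd q) {η θ : F} (hη : TypeS q η)
    (hθ : TypeE q θ) {W : Submodule F (Fin 4 → F)} (hW : Module.finrank F W = 2)
    (hgood : ∀ v ∈ W, v ≠ 0 → (dt v = 0 ∧ hm q v = 0) ∨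
      Inv q (η + η⁻¹) (η ^ (q + 1)) v ∨ Inv q (θ + θ⁻¹) (θ ^ (q - 1)) v)
    {s t : F} (hst : s ≠ 0 ∨ t ≠ 0) (hm : osec q s t ∈ W) : TangentLine q θ s t W := by
  refine ⟨hW, hm, fun X hX => ?_⟩
  have hb : bl (osec q s t) X = 0 := by
    by_contra hb
    obtain ⟨v, hv, hv0, h⟩ := exists_of_bl_ne_zero hq hb
    have hvW : v ∈ W := by
      refine (Submodule.span_le.2 ?_) hv
      rintro x (rfl | rfl) <;> assumption
    have hg := hgood v hvW hv0
    rcases h with ⟨h1, h2⟩ | ⟨h1, h2⟩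
    · rcases hg with hg | hg | hg
      · exact h2 hg.2
      · exact hg.1 h1
      · exact hg.1 h1
    · rcases hg with hg | hg | hg
      · simp [h1] at hg
      · have := hg.2.1
        rw [h1, h2, one_pow, mul_one] at this
        exact add_inv_ne_two hη.ne_zero hη.2 this.symm
      · have := hg.2.1
        rw [h1, h2, one_pow, mul_one] at this
        exact add_inv_ne_two hθ.2.2 hθ.2.1 this.symm
  refine ⟨hb, ?_⟩
  by_cases hX0 : X = 0
  · exact Or.inl ⟨0, by rw [hX0, zero_smul]⟩
  rcases hgood X hX hX0 with hg | hg | hg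
  · exact Or.inl (mem_span_osec hq hst hb hg.1 hg.2)
  · exact absurd hg (hη.not_inv hq hodd hst hb)
  · exact Or.inr hg

theorem tangentLine_span (hq : Nat.card F = q ^ 2) (hodd : Odd q) {θ s t : F}
    (hst : s ≠ 0 ∨ t ≠ 0) {X : Fin 4 → F} (hb : bl (osec q s t) X = 0)
    (hX : Inv q (θ + θ⁻¹) (θ ^ (q - 1)) X) :
    TangentLine q θ s t (Submodule.span F {osec q s t, X}) := by
  refine ⟨finrank_span_pair (osec_ne_zero hst) ?_, Submodule.subset_span (by simp), ?_⟩
  · rintro a rfl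
    exact hX.1 (by rw [dt_smul, dt_osec, mul_zero])
  · intro Y hY
    obtain ⟨a, b, rfl⟩ := Submodule.mem_span_pair.1 hY
    refine ⟨?_, ?_⟩
    · rw [bl_add_right, bl_smul_right, bl_smul_right, hb, bl_self, dt_osec]; ring
    · by_cases h0 : b = 0
      · exact Or.inl ⟨a, by rw [h0, zero_smul, add_zero]⟩
      · right
        have : a • osec q s t + b • X = b • (X + (a / b) • osec q s t) := by
          rw [smul_add, smul_smul, mul_div_cancel₀ _ h0, add_comm]
        rw [this, inv_smul_iff hq hodd h0, inv_add_smul_osec hq hb]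
        exact hX

/-- The unit group is cyclic of order 2(q-1)·(q+1)/2, so the condition on `a` makes it a (q+1)/2-th
power, and F contains all (q+1)/2-th roots of unity. -/
theorem ncard_pow_half_eq (hq : Nat.card F = q ^ 2) (hodd : Odd q) {a : F} (ha : a ≠ 0)
    (h : (a ^ (q - 1)) ^ 2 = 1) : {x : F | x ^ ((q + 1) / 2) = a}.ncard = (q + 1) / 2 := by
  classical
  obtain ⟨g, hg⟩ := IsCyclic.exists_generator (α := Fˣ)
  have hord : orderOf g = q ^ 2 - 1 := by
    rw [orderOf_eq_card_of_forall_mem_zpowers hg, Nat.card_units, hq]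
  have hq1 := one_lt_of_card hq
  have hpos : 0 < q ^ 2 - 1 := by
    have : 1 < q ^ 2 := Nat.one_lt_pow two_ne_zero hq1
    omega
  have hfac : q ^ 2 - 1 = ((q - 1) * 2) * ((q + 1) / 2) := by
    rw [mul_assoc, two_mul_half hodd, mul_comm]
    simpa using (Nat.sq_sub_sq q 1)
  have hprim : IsPrimitiveRoot (g ^ ((q - 1) * 2)) ((q + 1) / 2) :=
    (hord ▸ IsPrimitiveRoot.orderOf g).pow hpos hfac
  have hprim' : IsPrimitiveRoot ((g ^ ((q - 1) * 2) : Fˣ) : F) ((q + 1) / 2) :=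
    IsPrimitiveRoot.coe_units_iff.2 hprim
  have hex : ∃ α : F, α ^ ((q + 1) / 2) = a := by
    obtain ⟨i, hi⟩ := mem_powers_iff_mem_zpowers.2 (hg (Units.mk0 a ha))
    have h1 : g ^ (i * ((q - 1) * 2)) = 1 := by
      rw [pow_mul]
      simp only at hi
      rw [hi, Units.ext_iff, Units.val_pow_eq_pow_val, Units.val_mk0, pow_mul, h, Units.val_one]
    rw [← orderOf_dvd_iff_pow_eq_one, hord, hfac, mul_comm i] at h1
    obtain ⟨j, rfl⟩ := Nat.dvd_of_mul_dvd_mul_left (by omega) h1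
    refine ⟨(g ^ j : Fˣ), ?_⟩
    rw [← Units.val_pow_eq_pow_val, ← pow_mul, mul_comm]
    simp only at hi
    rw [hi, Units.val_mk0]
  have hm : 0 < (q + 1) / 2 := by omega
  have hset : {x : F | x ^ ((q + 1) / 2) = a} =
      ((Polynomial.nthRoots ((q + 1) / 2) a).toFinset : Set F) := by
    ext x
    simp [Polynomial.mem_nthRoots hm]
  rw [hset, Set.ncard_coe_finset, Multiset.toFinset_card_of_nodup (hprim'.nthRoots_nodup ha),
    hprim'.card_nthRoots, if_pos hex]

theorem TypeE.ncard_roots (hq : Nat.card F = q ^ 2) (hodd : Odd q) {θ : F} (h : TypeE q θ) :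
    {x : F | x ^ ((q + 1) / 2) = -θ ∨ x ^ ((q + 1) / 2) = -θ⁻¹}.ncard = q + 1 := by
  obtain ⟨h1, h2, h0⟩ := h
  have hne : -θ ≠ -θ⁻¹ := by
    intro h
    rw [neg_inj] at h
    have h' := mul_inv_cancel₀ h0
    rw [← h, ← sq] at h'
    exact h2 h'
  have e1 := ncard_pow_half_eq hq hodd (a := -θ) (neg_ne_zero.2 h0)
    (by rw [(even_sub_one hodd).neg_pow, h1])
  have e2 := ncard_pow_half_eq hq hodd (a := -θ⁻¹) (neg_ne_zero.2 (inv_ne_zero h0))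
    (by rw [(even_sub_one hodd).neg_pow, inv_pow, inv_pow, h1, inv_one])
  rw [Set.ofPred_or, Set.ncard_union_eq ?_ (Set.toFinite _) (Set.toFinite _), e1, e2, ← two_mul,
    two_mul_half hodd]
  rw [Set.disjoint_left]
  intro x hx hx'
  exact hne (hx.symm.trans hx')

/-- There are `q + 1` tangent lines of each surface of type `E` at each point of the curve. -/
theorem ncard_tangentLine (hq : Nat.card F = q ^ 2) (hodd : Odd q) {θ : F} (hθ : TypeE q θ)
    {s t : F} (hst : s ≠ 0 ∨ t ≠ 0) : {W | TangentLine q θ s t W}.ncard = q + 1 := by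
  obtain ⟨μ, ν, h1, h2, h3⟩ := exists_tangent_coords hq hst
  rw [← hθ.ncard_roots hq hodd]
  -- Each tangent line has one generator normalised to (0, 1, -x, ·), unique by `h3`.
  have key : {W | TangentLine q θ s t W} =
      (fun x : F => Submodule.span F {osec q s t, ![0, 1, -x, μ * 1 + ν * -x]}) ''
        {x : F | x ^ ((q + 1) / 2) = -θ ∨ x ^ ((q + 1) / 2) = -θ⁻¹} := by
    ext W
    simp only [Set.mem_ofPred_eq, Set.mem_image]
    constructor
    · intro hW
      obtain ⟨X, hXW, hX⟩ := exists_mem_not_mem_span hW.1 (osec q s t)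
      obtain ⟨hb, hi⟩ := hW.2.2 X hXW
      replace hi := hi.resolve_left (by rintro ⟨a, ha⟩; exact hX a ha)
      obtain ⟨a, b, c, rfl⟩ := h2 X hb
      rw [inv_add_smul_osec hq (h1 b c)] at hi
      have hb0 : b ≠ 0 := by
        rintro rfl
        exact hi.1 (by simp [dt])
      have hY : (![0, b, c, μ * b + ν * c] : Fin 4 → F) ∈ W :=
        (Submodule.add_mem_iff_left _ (Submodule.smul_mem _ a hW.2.1)).1 hXW
      have hd : (μ * b + ν * c) / b = μ * 1 + ν * -(-c / b) := by field_simp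
      rw [← smul_tangent_vec hb0, hd] at hi hY
      rw [inv_smul_iff hq hodd hb0] at hi
      rw [Submodule.smul_mem_iff _ hb0] at hY
      refine ⟨-c / b, (hθ.inv_tangent_iff hq hodd _ _).1 hi,
        span_pair_eq hW.1 (osec_ne_zero hst) hW.2.1 hY fun a ha => ?_⟩
      rw [ha] at hi
      exact hi.1 (by rw [dt_smul, dt_osec, mul_zero])
    · rintro ⟨x, hx, rfl⟩
      exact tangentLine_span hq hodd hst (h1 1 (-x)) ((hθ.inv_tangent_iff hq hodd _ _).2 hx)
  rw [key, Set.InjOn.ncard_image]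
  intro x _ y _ hxy
  have hmem : (![0, 1, -y, μ * 1 + ν * -y] : Fin 4 → F) ∈
      Submodule.span F {osec q s t, ![0, 1, -x, μ * 1 + ν * -x]} := by
    simp only at hxy
    rw [hxy]
    exact Submodule.subset_span (by simp)
  obtain ⟨a, b, hab⟩ := Submodule.mem_span_pair.1 hmem
  obtain ⟨-, hb, hc⟩ := h3 a (b - 1) (-(b * x) + y) (by
    rw [← sub_eq_zero] at hab
    rw [← hab]
    generalize a • osec q s t = w
    ext i
    fin_cases i <;> simp [Matrix.vecHead, Matrix.vecTail] <;> ring)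
  have hb' : b = 1 := sub_eq_zero.1 hb
  rw [hb'] at hc
  linear_combination -hc

/-- Through each point of a surface of type `E` off the curve there are exactly two tangent
lines of the surface. -/
theorem ncard_tangentLine_through (hq : Nat.card F = q ^ 2) (hodd : Odd q) {θ : F}
    (hθ : TypeE q θ) {X : Fin 4 → F} (hX : Inv q (θ + θ⁻¹) (θ ^ (q - 1)) X) :
    {W | (∃ s t : F, (s ≠ 0 ∨ t ≠ 0) ∧ TangentLine q θ s t W) ∧ X ∈ W}.ncard = 2 := by
  obtain ⟨x₁, y₁, x₂, y₂, hind, hz1, hz2, -, huniq⟩ := hθ.exists_isotropic hq hodd hX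
  have hne1 : -y₁ ≠ 0 ∨ x₁ ≠ 0 := by
    by_contra! h
    rw [neg_eq_zero] at h
    simp [h] at hind
  have hne2 : -y₂ ≠ 0 ∨ x₂ ≠ 0 := by
    by_contra! h
    rw [neg_eq_zero] at h
    simp [h] at hind
  have hb1 : bl (osec q (-y₁) x₁) X = 0 := by rw [bl_osec q hodd, neg_neg, hz1]
  have hb2 : bl (osec q (-y₂) x₂) X = 0 := by rw [bl_osec q hodd, neg_neg, hz2]
  have hXo : ∀ (s t a : F), X ≠ a • osec q s t := by
    rintro s t a rfl
    exact hX.1 (by rw [dt_smul, dt_osec, mul_zero])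
  -- Proportional isotropic vectors have the same contact point, and that point together with X
  -- spans W.
  have aux : ∀ (s t x y : F), (s ≠ 0 ∨ t ≠ 0) → ∀ W, TangentLine q θ s t W → X ∈ W →
      (∃ c, t = c * x ∧ -s = c * y) → W = Submodule.span F {osec q (-y) x, X} := by
    rintro s t x y hst W hW hXW ⟨c, hc1, hc2⟩
    obtain rfl : t = c * x := hc1
    obtain rfl : s = c * -y := by linear_combination -hc2
    have hc : c ≠ 0 := by
      rintro rfl
      simp at hst
    have hxy : -y ≠ 0 ∨ x ≠ 0 := by
      by_contra! h
      simp [h] at hst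
    have hm := hW.2.1
    rw [osec_smul_eq, Submodule.smul_mem_iff _ (pow_ne_zero _ hc)] at hm
    exact (span_pair_eq hW.1 (osec_ne_zero hxy) hm hXW (hXo _ _)).symm
  have key : {W | (∃ s t : F, (s ≠ 0 ∨ t ≠ 0) ∧ TangentLine q θ s t W) ∧ X ∈ W} =
      {Submodule.span F {osec q (-y₁) x₁, X}, Submodule.span F {osec q (-y₂) x₂, X}} := by
    ext W
    simp only [Set.mem_ofPred_eq, Set.mem_insert_iff, Set.mem_singleton_iff]
    constructor
    · rintro ⟨⟨s, t, hst, hW⟩, hXW⟩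
      have hb := (hW.2.2 X hXW).1
      rw [bl_osec q hodd] at hb
      exact (huniq _ _ hb).imp (aux s t _ _ hst W hW hXW) (aux s t _ _ hst W hW hXW)
    · rintro (rfl | rfl)
      · exact ⟨⟨_, _, hne1, tangentLine_span hq hodd hne1 hb1 hX⟩,
          Submodule.subset_span (by simp)⟩
      · exact ⟨⟨_, _, hne2, tangentLine_span hq hodd hne2 hb2 hX⟩,
          Submodule.subset_span (by simp)⟩
  rw [key, Set.ncard_pair]
  intro h
  have h1 := tangentLine_span hq hodd hne1 hb1 hX
  have h2 := (tangentLine_span hq hodd hne2 hb2 hX).2.1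
  rw [← h] at h2
  apply hind
  linear_combination -h1.cross_eq hne2 h2

end finite

/-! ### Passage to projective space and the line pattern. -/

theorem exists_rep_mk (v : Fin 4 → F) (hv : v ≠ 0) :
    ∃ a : F, a ≠ 0 ∧ (Projectivization.mk F v hv).rep = a • v := by
  obtain ⟨a, ha⟩ := Projectivization.exists_smul_eq_mk_rep F v hv
  exact ⟨a, a.ne_zero, by rw [← ha, Units.smul_def]⟩

theorem mk_osec_mem_O (q : ℕ) (s t : F) (h : osec q s t ≠ 0) :
    Projectivization.mk F (osec q s t) h ∈ O F q := ⟨s, t, h, rfl⟩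

theorem ne_zero_of_osec_ne_zero {q : ℕ} {s t : F} (h : osec q s t ≠ 0) : s ≠ 0 ∨ t ≠ 0 := by
  by_contra! h0
  exact h (by rw [h0.1, h0.2]; ext i; fin_cases i <;> simp [osec])

theorem exists_of_mem_O {q : ℕ} {P : PG3 F} (hP : P ∈ O F q) :
    ∃ s t, ∃ h : s ≠ 0 ∨ t ≠ 0, P = Projectivization.mk F (osec q s t) (osec_ne_zero h) := by
  obtain ⟨s, t, h, rfl⟩ := hP
  exact ⟨s, t, ne_zero_of_osec_ne_zero h, rfl⟩

theorem rep_mem_submodule_iff (l : Projectivization.Subspace F (Fin 4 → F)) (P : PG3 F) :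
    P.rep ∈ Projectivization.Subspace.submodule l ↔ P ∈ l := by
  rw [Projectivization.Subspace.mem_submodule_iff l P.rep_nonzero, P.mk_rep]

theorem ncard_submodule_preimage (p : Submodule F (Fin 4 → F) → Prop) :
    {l : Projectivization.Subspace F (Fin 4 → F) |
      p (Projectivization.Subspace.submodule l)}.ncard = {W | p W}.ncard := by
  rw [← Set.ncard_image_of_injective _
    (Projectivization.Subspace.submodule (K := F) (V := Fin 4 → F)).injective]
  congr 1
  ext W
  constructor
  · rintro ⟨l, hl, rfl⟩
    exact hl
  · intro hW
    exact ⟨Projectivization.Subspace.submodule.symm W, by simpa using hW, by simp⟩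

section finite

variable [Finite F] {q : ℕ}

theorem mem_O_iff (hq : Nat.card F = q ^ 2) (P : PG3 F) :
    P ∈ O F q ↔ dt P.rep = 0 ∧ hm q P.rep = 0 := by
  constructor
  · intro hP
    obtain ⟨s, t, h, rfl⟩ := exists_of_mem_O hP
    obtain ⟨a, -, ha⟩ := exists_rep_mk (osec q s t) (osec_ne_zero h)
    rw [ha, dt_smul, hm_smul, dt_osec, hm_osec, mul_zero, mul_zero]
    exact ⟨rfl, rfl⟩
  · rintro ⟨h1, h2⟩
    obtain ⟨c, s, t, hc, hst, h⟩ := exists_osec hq P.rep_nonzero h1 h2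
    have : P = Projectivization.mk F (osec q s t) (osec_ne_zero hst) := by
      rw [← P.mk_rep, Projectivization.mk_eq_mk_iff']
      exact ⟨c, h.symm⟩
    rw [this]
    exact mk_osec_mem_O q s t _

theorem inv_rep_mk_iff (hq : Nat.card F = q ^ 2) (hodd : Odd q) (γ ε : F) (v : Fin 4 → F)
    (hv : v ≠ 0) : Inv q γ ε (Projectivization.mk F v hv).rep ↔ Inv q γ ε v := by
  obtain ⟨a, ha, h⟩ := exists_rep_mk v hv
  rw [h, inv_smul_iff hq hodd ha]

/-- The curve has `q^2 + 1` points. -/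
theorem ncard_O (hq : Nat.card F = q ^ 2) : (O F q).ncard = q ^ 2 + 1 := by
  have h01 : (0 : F) ≠ 0 ∨ (1 : F) ≠ 0 := Or.inr one_ne_zero
  have h1 (t : F) : (1 : F) ≠ 0 ∨ t ≠ 0 := Or.inl one_ne_zero
  let f : Option F → PG3 F := fun x => x.elim
    (Projectivization.mk F (osec q 0 1) (osec_ne_zero h01))
    (fun t => Projectivization.mk F (osec q 1 t) (osec_ne_zero (h1 t)))
  have hinj : Function.Injective f := by
    rintro (_ | t) (_ | t') h
    · rfl
    · obtain ⟨a, ha⟩ := (Projectivization.mk_eq_mk_iff' F _ _ _ _).1 h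
      have := cross_eq_of_osec_eq h01 ha.symm
      simp at this
    · obtain ⟨a, ha⟩ := (Projectivization.mk_eq_mk_iff' F _ _ _ _).1 h
      have := cross_eq_of_osec_eq (h1 t) ha.symm
      simp at this
    · obtain ⟨a, ha⟩ := (Projectivization.mk_eq_mk_iff' F _ _ _ _).1 h
      have := cross_eq_of_osec_eq (h1 t) ha.symm
      rw [one_mul, one_mul] at this
      rw [this]
  have hrange : Set.range f = O F q := by
    ext P
    constructor
    · rintro ⟨_ | t, rfl⟩
      · exact mk_osec_mem_O q _ _ _
      · exact mk_osec_mem_O q _ _ _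
    · intro hP
      obtain ⟨s, t, hst, rfl⟩ := exists_of_mem_O hP
      by_cases hs : s = 0
      · subst hs
        refine ⟨none, ?_⟩
        have ht : t ≠ 0 := by tauto
        refine (Projectivization.mk_eq_mk_iff' F _ _ _ _).2 ⟨(t⁻¹) ^ (q + 1), ?_⟩
        rw [← osec_smul_eq, mul_zero, inv_mul_cancel₀ ht]
      · refine ⟨some (t / s), ?_⟩
        refine (Projectivization.mk_eq_mk_iff' F _ _ _ _).2 ⟨(s⁻¹) ^ (q + 1), ?_⟩
        rw [← osec_smul_eq, inv_mul_cancel₀ hs, inv_mul_eq_div]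
  rw [← hrange, ← Nat.card_coe_set_eq, Nat.card_range_of_injective hinj, Finite.card_option, hq]

/-- `A` need only be part of its stratum, as no line of V meets it; `B` must be the full stratum, so
that every tangent line lies in V. -/
theorem linePattern_of (hq : Nat.card F = q ^ 2) (hodd : Odd q) {η θ : F} (hη : TypeS q η)
    (hθ : TypeE q θ) (hγ : η + η⁻¹ ≠ 0 ∨ θ + θ⁻¹ ≠ 0) {V A B : Set (PG3 F)}
    (hV : V = O F q ∪ A ∪ B) (hA : ∀ P ∈ A, Inv q (η + η⁻¹) (η ^ (q + 1)) P.rep)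
    (hB : ∀ P, P ∈ B ↔ Inv q (θ + θ⁻¹) (θ ^ (q - 1)) P.rep) :
    LinePattern q V A B (O F q) := by
  have hgood : ∀ l ∈ linesIn V, ∀ v ∈ Projectivization.Subspace.submodule l, v ≠ 0 →
      (dt v = 0 ∧ hm q v = 0) ∨
      Inv q (η + η⁻¹) (η ^ (q + 1)) v ∨ Inv q (θ + θ⁻¹) (θ ^ (q - 1)) v := by
    intro l hl v hv h0
    have hmem := hl.2 ((Projectivization.Subspace.mem_submodule_iff l h0).1 hv)
    rw [hV] at hmem
    rcases hmem with (h | h) | h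
    · left
      rw [mem_O_iff hq] at h
      obtain ⟨a, ha, hr⟩ := exists_rep_mk v h0
      rwa [hr, dt_smul, hm_smul, mul_eq_zero, mul_eq_zero,
        or_iff_right (pow_ne_zero _ ha), or_iff_right (pow_ne_zero _ ha)] at h
    · exact Or.inr (Or.inl ((inv_rep_mk_iff hq hodd _ _ v h0).1 (hA _ h)))
    · exact Or.inr (Or.inr ((inv_rep_mk_iff hq hodd _ _ v h0).1 ((hB _).1 h)))
  have hlines_of : ∀ l s t, (s ≠ 0 ∨ t ≠ 0) →
      TangentLine q θ s t (Projectivization.Subspace.submodule l) → l ∈ linesIn V := by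
    intro l s t hst h
    refine ⟨h.1, fun P hP => ?_⟩
    rw [hV]
    rcases (h.2.2 P.rep ((rep_mem_submodule_iff l P).2 hP)).2 with ⟨a, ha⟩ | hi
    · left; left
      rw [mem_O_iff hq, ha, dt_smul, hm_smul, dt_osec, hm_osec, mul_zero, mul_zero]
      exact ⟨rfl, rfl⟩
    · exact Or.inr ((hB P).2 hi)
  have hlines : ∀ l, l ∈ linesIn V ↔ ∃ s t : F, (s ≠ 0 ∨ t ≠ 0) ∧
      TangentLine q θ s t (Projectivization.Subspace.submodule l) := by
    intro l
    constructor
    · intro hl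
      obtain ⟨s, t, hst, hm⟩ := exists_osec_mem hq hodd (pow_ne_zero _ hη.ne_zero)
        (pow_ne_zero _ hθ.2.2) hγ hl.1 (hgood l hl)
      exact ⟨s, t, hst, tangentLine_of_mem hq hodd hη hθ hl.1 (hgood l hl) hst hm⟩
    · rintro ⟨s, t, hst, h⟩
      exact hlines_of l s t hst h
  have hO : ∀ P ∈ O F q, {l ∈ linesIn V | P ∈ l}.ncard = q + 1 := by
    intro P hP
    obtain ⟨s, t, hst, rfl⟩ := exists_of_mem_O hP
    rw [← ncard_tangentLine hq hodd hθ hst, ← ncard_submodule_preimage]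
    congr 1
    ext l
    constructor
    · rintro ⟨hl, hm⟩
      exact tangentLine_of_mem hq hodd hη hθ hl.1 (hgood l hl) hst
        ((Projectivization.Subspace.mem_submodule_iff l _).2 hm)
    · intro h
      exact ⟨hlines_of l s t hst h, (Projectivization.Subspace.mem_submodule_iff l _).1 h.2.1⟩
  refine ⟨?_, ?_, ?_, hO⟩
  · have : Finite (Projectivization.Subspace F (Fin 4 → F)) :=
      Finite.of_injective _ Projectivization.Subspace.submodule.injective
    -- The union is disjoint because each such line has a single curve point.
    have hunion : linesIn V = ⋃ P ∈ O F q, {l ∈ linesIn V | P ∈ l} := by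
      ext l
      simp only [Set.mem_iUnion, Set.mem_ofPred_eq, exists_prop, hlines]
      constructor
      · rintro ⟨s, t, hst, h⟩
        exact ⟨_, mk_osec_mem_O q s t (osec_ne_zero hst), ⟨s, t, hst, h⟩,
          (Projectivization.Subspace.mem_submodule_iff l _).1 h.2.1⟩
      · rintro ⟨P, -, h, -⟩
        exact h
    rw [hunion, (Set.toFinite (O F q)).ncard_biUnion (fun _ _ => Set.toFinite _),
      finsum_mem_congr rfl hO, finsum_mem_eq_finite_toFinset_sum _ (Set.toFinite _),
      Finset.sum_const, ← Set.ncard_eq_toFinset_card, ncard_O hq, smul_eq_mul, mul_comm]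
    intro P hP Q hQ hPQ
    rw [Function.onFun, Set.disjoint_left]
    rintro l ⟨hl, hPl⟩ ⟨-, hQl⟩
    apply hPQ
    obtain ⟨s, t, hst, rfl⟩ := exists_of_mem_O hP
    have hT := tangentLine_of_mem hq hodd hη hθ hl.1 (hgood l hl) hst
        ((Projectivization.Subspace.mem_submodule_iff l _).2 hPl)
    rcases (hT.2.2 Q.rep ((rep_mem_submodule_iff l Q).2 hQl)).2 with ⟨a, ha⟩ | hi
    · rw [← Q.mk_rep, eq_comm, Projectivization.mk_eq_mk_iff']
      exact ⟨a, ha.symm⟩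
    · exact absurd ((mem_O_iff hq Q).1 hQ).1 hi.1
  · intro P hP l hl hPl
    obtain ⟨s, t, hst, h⟩ := (hlines l).1 hl
    exact hη.not_inv hq hodd hst (h.2.2 P.rep ((rep_mem_submodule_iff l P).2 hPl)).1 (hA P hP)
  · intro P hP
    rw [← ncard_tangentLine_through hq hodd hθ ((hB P).1 hP), ← ncard_submodule_preimage]
    congr 1
    ext l
    simp only [Set.mem_ofPred_eq, hlines, rep_mem_submodule_iff]

/-- The points of a surface of type `S` or `E` off the curve. -/
theorem mem_surface_diff_O_iff (hq : Nat.card F = q ^ 2) {γ ε : F} (hγ : γ ≠ 0)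
    (hε : ε ^ 2 = 1) (hf : γ ^ q = ε * γ) (P : PG3 F) :
    P ∈ surface q γ \ O F q ↔ Inv q γ ε P.rep := by
  rw [Set.mem_sdiff, mem_O_iff hq]
  change form q γ P.rep = 0 ∧ _ ↔ _
  rw [form_eq, sub_eq_zero]
  have hm0 : (q + 1) / 2 ≠ 0 := by have := one_lt_of_card hq; omega
  constructor
  · rintro ⟨h1, h2⟩
    have hd : dt P.rep ≠ 0 := by
      intro hd
      rw [hd, zero_pow hm0, mul_zero] at h1
      exact h2 ⟨hd, h1⟩
    refine ⟨hd, h1, ?_⟩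
    -- `hm` is fixed by conjugation; cancelling γ ≠ 0 leaves the character of `dt`.
    have h3 := frob_hm hq P.rep
    rw [h1, map_mul, frob_apply, frob_apply, hf, mul_right_comm, mul_comm] at h3
    have hdm := pow_ne_zero ((q + 1) / 2) hd
    have h4 := mul_left_cancel₀ hγ h3
    have hq0 : q ≠ 0 := by have := one_lt_of_card hq; omega
    rw [← pow_sub_one_mul hq0] at h4
    have h5 : (dt P.rep ^ ((q + 1) / 2)) ^ (q - 1) * ε = 1 :=
      mul_right_cancel₀ hdm (by linear_combination h4)
    rw [mul_comm, pow_mul]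
    linear_combination ε * h5 - (dt P.rep ^ ((q + 1) / 2)) ^ (q - 1) * hε
  · rintro ⟨h1, h2, -⟩
    exact ⟨h2, fun h => h1 h.1⟩

theorem O_subset_surface (hq : Nat.card F = q ^ 2) (γ : F) : O F q ⊆ surface q γ := by
  intro P hP
  obtain ⟨h1, h2⟩ := (mem_O_iff hq P).1 hP
  have hm0 : (q + 1) / 2 ≠ 0 := by have := one_lt_of_card hq; omega
  change form q γ P.rep = 0
  rw [form_eq, h1, h2, zero_pow hm0, mul_zero, sub_zero]

end finite

/-! ### The action of K and its orbits. -/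

theorem exists_specialLinear (a b c d : F) (h : a * d - b * c = 1) :
    ∃ A : SL(2, F), A 0 0 = a ∧ A 0 1 = b ∧ A 1 0 = c ∧ A 1 1 = d :=
  ⟨⟨!![a, b; c, d], by rw [Matrix.det_fin_two_of, h]⟩, rfl, rfl, rfl, rfl⟩

theorem add_inv_ne_zero {η : F} (h : η ^ 4 ≠ 1) (h0 : η ≠ 0) : η + η⁻¹ ≠ 0 := by
  intro h1
  field_simp at h1
  exact h (by linear_combination (η ^ 2 - 1) * h1)

theorem add_inv_eq_zero {η : F} (h : η ^ 4 = 1) (h2 : η ^ 2 ≠ 1) (h0 : η ≠ 0) :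
    η + η⁻¹ = 0 := by
  have h1 : (η ^ 2 - 1) * (η ^ 2 + 1) = 0 := by linear_combination h
  have h3 := (mul_eq_zero.1 h1).resolve_left (sub_ne_zero.2 h2)
  have h4 : η * (η + η⁻¹) = 0 := by rw [mul_add, mul_inv_cancel₀ h0, ← sq, h3]
  exact (mul_eq_zero.1 h4).resolve_left h0

section finite

variable [Finite F] {q : ℕ}

/-- The action evaluates the form on pairs of rows of A, i.e. changes basis. -/
theorem twistedSquare_mulVec (hq : Nat.card F = q ^ 2) (A : SL(2, F)) (v : Fin 4 → F) :
    (twistedSquare hq A).mulVec v = ![sesq q v (A 0 0) (A 0 1) (A 0 0) (A 0 1),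
      sesq q v (A 0 0) (A 0 1) (A 1 0) (A 1 1), sesq q v (A 1 0) (A 1 1) (A 0 0) (A 0 1),
      sesq q v (A 1 0) (A 1 1) (A 1 0) (A 1 1)] := by
  ext i
  fin_cases i <;>
    simp [twistedSquare, Matrix.mulVec, dotProduct, Fin.sum_univ_four, sesq, finProdFinEquiv,
      Fin.divNat, Fin.modNat, frob_apply] <;> ring

theorem dt_twistedSquare (hq : Nat.card F = q ^ 2) (A : SL(2, F)) (v : Fin 4 → F) :
    dt ((twistedSquare hq A).mulVec v) = dt v := by
  have h1 := A.det_coe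
  rw [Matrix.det_fin_two] at h1
  have h2 := congrArg (frob hq) h1
  simp only [map_sub, map_mul, map_one] at h2
  rw [twistedSquare_mulVec]
  simp only [dt, sesq_eq hq, Matrix.cons_val]
  linear_combination (v 0 * v 3 - v 1 * v 2) * h2 + (v 0 * v 3 - v 1 * v 2) *
    (frob hq (A 0 0) * frob hq (A 1 1) - frob hq (A 0 1) * frob hq (A 1 0)) * h1

theorem hm_twistedSquare (hq : Nat.card F = q ^ 2) (A : SL(2, F)) (v : Fin 4 → F) :
    hm q ((twistedSquare hq A).mulVec v) = hm q v := by
  have h1 := A.det_coe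
  rw [Matrix.det_fin_two] at h1
  have h2 := congrArg (frob hq) h1
  simp only [map_sub, map_mul, map_one] at h2
  rw [twistedSquare_mulVec]
  simp only [hm_eq hq, sesq_eq hq, Matrix.cons_val, map_add, map_mul, frob_frob]
  linear_combination (frob hq (v 0) * v 3 + v 0 * frob hq (v 3) - frob hq (v 1) * v 1
    - frob hq (v 2) * v 2) * (h2 +
    (frob hq (A 0 0) * frob hq (A 1 1) - frob hq (A 0 1) * frob hq (A 1 0)) * h1)

theorem mem_orbit_K_iff (hq : Nat.card F = q ^ 2) (v w : Fin 4 → F) (hv : v ≠ 0) (hw : w ≠ 0) :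
    Projectivization.mk F w hw ∈ MulAction.orbit (K hq) (Projectivization.mk F v hv : PG3 F) ↔
      ∃ (A : SL(2, F)) (c : F), (twistedSquare hq A).mulVec v = c • w := by
  constructor
  · rintro ⟨⟨_, A, rfl⟩, h⟩
    refine ⟨A, ?_⟩
    obtain ⟨c, hc⟩ := (Projectivization.mk_eq_mk_iff' F _ _ _ _).1 h
    exact ⟨c, hc.symm⟩
  · rintro ⟨A, c, h⟩
    refine ⟨⟨_, A, rfl⟩, ?_⟩
    refine (Projectivization.mk_eq_mk_iff' F _ _ _ _).2 ⟨c, ?_⟩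
    exact h.symm

theorem inv_of_mem_orbit (hq : Nat.card F = q ^ 2) (hodd : Odd q) {γ ε : F} {v : Fin 4 → F}
    (hv : v ≠ 0) (hi : Inv q γ ε v) {P : PG3 F}
    (hP : P ∈ MulAction.orbit (K hq) (Projectivization.mk F v hv : PG3 F)) :
    Inv q γ ε P.rep := by
  rw [← P.mk_rep, mem_orbit_K_iff] at hP
  obtain ⟨A, c, h⟩ := hP
  have h1 : Inv q γ ε (c • P.rep) := by
    rw [← h, Inv, dt_twistedSquare, hm_twistedSquare]
    exact hi
  have hc : c ≠ 0 := by
    rintro rfl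
    exact h1.ne_zero (zero_smul _ _)
  exact (inv_smul_iff hq hodd hc).1 h1

/-- With ε = η^(q+1) = ε⁻¹, conjugation sends η to εη⁻¹; for type E it sends θ to εθ. -/
theorem TypeS.pow_add_inv (hq : Nat.card F = q ^ 2) {η : F} (h : TypeS q η) :
    (η + η⁻¹) ^ q = η ^ (q + 1) * (η + η⁻¹) := by
  have h0 := h.ne_zero
  have h1 := h.1
  rw [← frob_apply hq, map_add, map_inv₀, frob_apply]
  rw [pow_succ] at h1 ⊢
  have := pow_ne_zero q h0
  field_simp
  linear_combination -h1

theorem TypeE.pow_add_inv (hq : Nat.card F = q ^ 2) {θ : F} (h : TypeE q θ) :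
    (θ + θ⁻¹) ^ q = θ ^ (q - 1) * (θ + θ⁻¹) := by
  obtain ⟨h1, -, h0⟩ := h
  have hq1 : q = (q - 1) + 1 := by have := one_lt_of_card hq; omega
  have e : θ ^ q = θ ^ (q - 1) * θ := by rw [← pow_succ, ← hq1]
  rw [← frob_apply hq, map_add, map_inv₀, frob_apply, e]
  have := pow_ne_zero (q - 1) h0
  field_simp
  linear_combination -h1

/-- The orbit of `(0, β, 1, 0)` is a full stratum of the Hermitian surface. -/
theorem mem_orbit_of_inv (hq : Nat.card F = q ^ 2) (hodd : Odd q) {θ : F} (hθ : TypeE q θ)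
    (h0 : θ + θ⁻¹ = 0) {β : F} (hv : (![0, β, 1, 0] : Fin 4 → F) ≠ 0)
    (hβ : ∀ b : F, b ^ (q + 1) = -1 → ∃ s : F, s ≠ 0 ∧
      (b = β * s ^ (2 * (q - 1)) ∨ b * β = s ^ (2 * (q - 1))))
    {P : PG3 F} (hP : Inv q (θ + θ⁻¹) (θ ^ (q - 1)) P.rep) :
    P ∈ MulAction.orbit (K hq) (Projectivization.mk F _ hv : PG3 F) := by
  have hq0 : q ≠ 0 := by have := one_lt_of_card hq; omega
  obtain ⟨x₁, y₁, x₂, y₂, hind, hz1, hz2, hp, -⟩ := hθ.exists_isotropic hq hodd hP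
  -- The rows form an isotropic basis, which makes the matrix antidiagonal; dividing the first row
  -- by the determinant puts A in SL(2).
  obtain ⟨A, a00, a01, a10, a11⟩ := exists_specialLinear (x₁ / (x₁ * y₂ - x₂ * y₁))
    (y₁ / (x₁ * y₂ - x₂ * y₁)) x₂ y₂ (by field_simp)
  obtain ⟨b, c, hc, hA⟩ : ∃ b c : F, c ≠ 0 ∧
      (twistedSquare hq A).mulVec P.rep = c • ![0, b, 1, 0] := by
    have e1 : sesq q P.rep (A 0 0) (A 0 1) (A 0 0) (A 0 1) = 0 := by
      have : sesq q P.rep (A 0 0) (A 0 1) (A 0 0) (A 0 1) =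
          (frob hq (x₁ * y₂ - x₂ * y₁))⁻¹ * (x₁ * y₂ - x₂ * y₁)⁻¹ *
            sesq q P.rep x₁ y₁ x₁ y₁ := by
        simp only [sesq_eq hq, a00, a01, map_div₀]
        ring
      rw [this, hz1, mul_zero]
    have e2 : sesq q P.rep (A 1 0) (A 1 1) (A 1 0) (A 1 1) = 0 := by
      rw [a10, a11, hz2]
    have e3 : sesq q P.rep (A 1 0) (A 1 1) (A 0 0) (A 0 1) ≠ 0 := by
      have : sesq q P.rep (A 1 0) (A 1 1) (A 0 0) (A 0 1) =
          (x₁ * y₂ - x₂ * y₁)⁻¹ * sesq q P.rep x₂ y₂ x₁ y₁ := by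
        simp only [sesq_eq hq, a00, a01, a10, a11]
        ring
      rw [this]
      exact mul_ne_zero (inv_ne_zero hind) hp
    refine ⟨sesq q P.rep (A 0 0) (A 0 1) (A 1 0) (A 1 1) /
      sesq q P.rep (A 1 0) (A 1 1) (A 0 0) (A 0 1), _, e3, ?_⟩
    rw [twistedSquare_mulVec, e1, e2]
    generalize sesq q P.rep (A 1 0) (A 1 1) (A 0 0) (A 0 1) = z at *
    ext i
    fin_cases i <;> simp
    field_simp
  have hQ : (![0, b, 1, 0] : Fin 4 → F) ≠ 0 := fun h => by simpa using congrFun h 2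
  have hQP : Projectivization.mk F _ hQ ∈ MulAction.orbit (K hq) P := by
    have := (mem_orbit_K_iff hq P.rep _ P.rep_nonzero hQ).2 ⟨A, c, hA⟩
    rwa [P.mk_rep] at this
  have hb : b ^ (q + 1) = -1 := by
    have h1 : hm q (c • ![0, b, 1, 0]) = 0 := by
      rw [← hA, hm_twistedSquare, hP.2.1, h0, zero_mul]
    rw [hm_smul, mul_eq_zero, or_iff_right (pow_ne_zero _ hc)] at h1
    simp [hm, hq0] at h1
    linear_combination -h1
  have hb0 : b ≠ 0 := by
    rintro rfl
    simp at hb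
  have hQβ : Projectivization.mk F _ hQ ∈
      MulAction.orbit (K hq) (Projectivization.mk F _ hv : PG3 F) := by
    rw [mem_orbit_K_iff]
    obtain ⟨s, hs, h⟩ := hβ b hb
    have hqs : s ^ q = s ^ (q - 1) * s := by rw [pow_sub_one_mul hq0]
    have hs1 := pow_ne_zero (q - 1) hs
    rw [mul_comm 2, pow_mul] at h
    -- diag(s, s⁻¹) multiplies the ratio β by s^(2(q-1)); the antidiagonal matrix also inverts it.
    rcases h with h | h
    · obtain ⟨A', a00, a01, a10, a11⟩ := exists_specialLinear s 0 0 s⁻¹ (by field_simp; ring)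
      refine ⟨A', (s ^ (q - 1))⁻¹, ?_⟩
      rw [twistedSquare_mulVec, a00, a01, a10, a11]
      ext i
      fin_cases i
      · simp [sesq, hq0]
      · simp [sesq, hq0, hqs, h]; field_simp
      · simp [sesq, hq0, hqs]; field_simp
      · simp [sesq, hq0]
    · have hβ0 : β ≠ 0 := by
        rintro rfl
        rw [mul_zero] at h
        exact pow_ne_zero 2 hs1 h.symm
      obtain ⟨A', a00, a01, a10, a11⟩ := exists_specialLinear 0 s (-s⁻¹) 0 (by field_simp; ring)
      refine ⟨A', -β * (s ^ (q - 1))⁻¹, ?_⟩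
      rw [twistedSquare_mulVec, a00, a01, a10, a11]
      ext i
      fin_cases i
      · simp [sesq, hq0]
      · simp [sesq, hq0, hqs]; field_simp; linear_combination -h
      · simp [sesq, hq0, hqs, hodd.neg_pow]; field_simp
      · simp [sesq, hq0]
  rw [← MulAction.orbit_eq_iff] at hQP hQβ
  rw [← MulAction.orbit_eq_iff, ← hQP, hQβ]

end finite

/-! ### Exponents of the primitive element, with q = 2n+1. -/

theorem generator_pow_eq_one_iff {n : ℕ} {ξ : Fˣ} (hq : Nat.card F = (2 * n + 1) ^ 2)
    (hξ : ∀ x : Fˣ, x ∈ Subgroup.zpowers ξ) (i : ℕ) :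
    (ξ : F) ^ i = 1 ↔ 4 * n * (n + 1) ∣ i := by
  have hord : orderOf ξ = 4 * n * (n + 1) := by
    rw [orderOf_eq_card_of_forall_mem_zpowers hξ, Nat.card_units, hq]
    have : (2 * n + 1) ^ 2 = 4 * n * (n + 1) + 1 := by ring
    omega
  rw [← Units.val_pow_eq_pow_val, Units.val_eq_one, ← hord, orderOf_dvd_iff_pow_eq_one]

theorem S_eq {n : ℕ} (ξ : Fˣ) (j : ℕ) : S (2 * n + 1) ξ j =
    surface (2 * n + 1) ((ξ : F) ^ (j * n) + ((ξ : F) ^ (j * n))⁻¹) := by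
  simp [S]

theorem E_eq {n : ℕ} (ξ : Fˣ) (k : ℕ) : E (2 * n + 1) ξ k =
    surface (2 * n + 1) ((ξ : F) ^ (k * (n + 1)) + ((ξ : F) ^ (k * (n + 1)))⁻¹) := by
  have e : (2 * n + 1 + 1) / 2 = n + 1 := by omega
  simp [E, e]

section generator

variable [Finite F] {n : ℕ} {ξ : Fˣ}

theorem pos_of_card (hq : Nat.card F = (2 * n + 1) ^ 2) : 0 < n := by
  have := one_lt_of_card hq
  omega

theorem generator_pow_half (hq : Nat.card F = (2 * n + 1) ^ 2)
    (hξ : ∀ x : Fˣ, x ∈ Subgroup.zpowers ξ) : (ξ : F) ^ (2 * n * (n + 1)) = -1 := by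
  have hn := pos_of_card hq
  have h1 : (ξ : F) ^ (2 * n * (n + 1)) ≠ 1 := by
    rw [Ne, generator_pow_eq_one_iff hq hξ]
    intro h
    have := Nat.le_of_dvd (by positivity) h
    nlinarith
  have h2 : ((ξ : F) ^ (2 * n * (n + 1))) ^ 2 = 1 := by
    rw [← pow_mul, generator_pow_eq_one_iff hq hξ]
    exact ⟨1, by ring⟩
  have h3 : ((ξ : F) ^ (2 * n * (n + 1)) - 1) * ((ξ : F) ^ (2 * n * (n + 1)) + 1) = 0 := by
    linear_combination h2
  exact eq_neg_of_add_eq_zero_left ((mul_eq_zero.1 h3).resolve_left (sub_ne_zero.2 h1))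

theorem typeS_generator_pow (hq : Nat.card F = (2 * n + 1) ^ 2)
    (hξ : ∀ x : Fˣ, x ∈ Subgroup.zpowers ξ) {j : ℕ} (h1 : 1 ≤ j) (h2 : j ≤ 2 * n + 1) :
    TypeS (2 * n + 1) ((ξ : F) ^ (j * n)) := by
  have hn := pos_of_card hq
  constructor
  · rw [← pow_mul, ← pow_mul, generator_pow_eq_one_iff hq hξ]
    exact ⟨j, by ring⟩
  · rw [← pow_mul, Ne, generator_pow_eq_one_iff hq hξ]
    intro h
    have h3 : (2 * n) * (2 * (n + 1)) ∣ (2 * n) * j := by convert h using 1 <;> ring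
    have := Nat.le_of_dvd h1 (Nat.dvd_of_mul_dvd_mul_left (by omega) h3)
    omega

/-- Through `add_inv_ne_zero` this gives γ ≠ 0: the excluded index is the only one in range yielding
a fourth root of unity. -/
theorem generator_pow_ne_of_ne_half (hq : Nat.card F = (2 * n + 1) ^ 2)
    (hξ : ∀ x : Fˣ, x ∈ Subgroup.zpowers ξ) {j : ℕ} (h1 : 1 ≤ j) (h2 : j ≤ 2 * n + 1)
    (h3 : j ≠ n + 1) : ((ξ : F) ^ (j * n)) ^ 4 ≠ 1 := by
  have hn := pos_of_card hq
  rw [← pow_mul, Ne, generator_pow_eq_one_iff hq hξ]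
  intro h
  have h4 : (4 * n) * (n + 1) ∣ (4 * n) * j := by convert h using 1; ring
  obtain ⟨c, rfl⟩ := Nat.dvd_of_mul_dvd_mul_left (by omega) h4
  have : c = 1 := by
    have : c ≠ 0 := by rintro rfl; simp at h1
    have : c < 2 := by by_contra! hc; nlinarith
    omega
  exact h3 (by rw [this, mul_one])

theorem typeE_generator_pow (hq : Nat.card F = (2 * n + 1) ^ 2)
    (hξ : ∀ x : Fˣ, x ∈ Subgroup.zpowers ξ) {k : ℕ} (h1 : 1 ≤ k) (h2 : k ≤ 2 * n - 1) :
    TypeE (2 * n + 1) ((ξ : F) ^ (k * (n + 1))) := by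
  have hn := pos_of_card hq
  refine ⟨?_, ?_, pow_ne_zero _ ξ.ne_zero⟩
  · rw [← pow_mul, ← pow_mul, generator_pow_eq_one_iff hq hξ, Nat.add_sub_cancel]
    exact ⟨k, by ring⟩
  · rw [← pow_mul, Ne, generator_pow_eq_one_iff hq hξ]
    intro h
    have h3 : (2 * (n + 1)) * (2 * n) ∣ (2 * (n + 1)) * k := by convert h using 1 <;> ring
    have := Nat.le_of_dvd h1 (Nat.dvd_of_mul_dvd_mul_left (by omega) h3)
    omega

theorem generator_pow_ne_of_ne_half' (hq : Nat.card F = (2 * n + 1) ^ 2)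
    (hξ : ∀ x : Fˣ, x ∈ Subgroup.zpowers ξ) {k : ℕ} (h1 : 1 ≤ k) (h2 : k ≤ 2 * n - 1)
    (h3 : k ≠ n) : ((ξ : F) ^ (k * (n + 1))) ^ 4 ≠ 1 := by
  have hn := pos_of_card hq
  rw [← pow_mul, Ne, generator_pow_eq_one_iff hq hξ]
  intro h
  have h4 : (4 * (n + 1)) * n ∣ (4 * (n + 1)) * k := by convert h using 1 <;> ring
  obtain ⟨c, rfl⟩ := Nat.dvd_of_mul_dvd_mul_left (by omega) h4
  have : c = 1 := by
    have : c ≠ 0 := by rintro rfl; simp at h1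
    have : c < 2 := by
      by_contra! hc
      have : n * 2 ≤ n * c := Nat.mul_le_mul_left n hc
      omega
    omega
  exact h3 (by rw [this, mul_one])

theorem add_inv_generator_quarter (hq : Nat.card F = (2 * n + 1) ^ 2)
    (hξ : ∀ x : Fˣ, x ∈ Subgroup.zpowers ξ) :
    (ξ : F) ^ (n * (n + 1)) + ((ξ : F) ^ (n * (n + 1)))⁻¹ = 0 := by
  have hn := pos_of_card hq
  refine add_inv_eq_zero ?_ (typeE_generator_pow hq hξ hn (by omega)).2.1
    (pow_ne_zero _ ξ.ne_zero)
  rw [← pow_mul, generator_pow_eq_one_iff hq hξ]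
  exact ⟨1, by ring⟩

/-- Both b and ξⁿ have norm -1, so bξⁿ is a power of ξ^(q-1); the parity of its exponent selects the
alternative. -/
theorem exists_norm_neg_one (hq : Nat.card F = (2 * n + 1) ^ 2)
    (hξ : ∀ x : Fˣ, x ∈ Subgroup.zpowers ξ) (b : F) (hb : b ^ (2 * n + 1 + 1) = -1) :
    ∃ s : F, s ≠ 0 ∧ (b = (ξ : F) ^ n * s ^ (2 * (2 * n + 1 - 1)) ∨
      b * (ξ : F) ^ n = s ^ (2 * (2 * n + 1 - 1))) := by
  have hn := pos_of_card hq
  have hb0 : b ≠ 0 := by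
    rintro rfl
    simp at hb
  obtain ⟨i, hi⟩ := mem_powers_iff_mem_zpowers.2 (hξ (Units.mk0 b hb0))
  have hbi : b = (ξ : F) ^ i := by
    have := congrArg Units.val hi
    simpa using this.symm
  have h1 : (ξ : F) ^ (2 * (n + 1) * (i + n)) = 1 := by
    have e : 2 * (n + 1) * (i + n) = i * (2 * n + 1 + 1) + 2 * n * (n + 1) := by ring
    rw [e, pow_add, pow_mul, ← hbi, hb, generator_pow_half hq hξ]
    ring
  rw [generator_pow_eq_one_iff hq hξ] at h1
  have h2 : (2 * (n + 1)) * (2 * n) ∣ (2 * (n + 1)) * (i + n) := by convert h1 using 1; ring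
  obtain ⟨l, hl⟩ := Nat.dvd_of_mul_dvd_mul_left (by omega) h2
  have hbl : b * (ξ : F) ^ n = (ξ : F) ^ (2 * n * l) := by rw [hbi, ← pow_add, hl]
  rw [Nat.add_sub_cancel]
  obtain ⟨r, rfl | rfl⟩ := Nat.even_or_odd' l
  · refine ⟨(ξ : F) ^ r, pow_ne_zero _ ξ.ne_zero, Or.inr ?_⟩
    rw [hbl, ← pow_mul]
    congr 1
    ring
  · refine ⟨(ξ : F) ^ r, pow_ne_zero _ ξ.ne_zero, Or.inl ?_⟩
    refine mul_right_cancel₀ (pow_ne_zero n ξ.ne_zero) (hbl.trans ?_)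
    rw [← pow_mul, ← pow_add, ← pow_add]
    congr 1
    ring

theorem inv_of_mem_H₁ (hq : Nat.card F = (2 * n + 1) ^ 2)
    (hξ : ∀ x : Fˣ, x ∈ Subgroup.zpowers ξ) {P : PG3 F} (hP : P ∈ H₁ hq ξ) :
    Inv (2 * n + 1) ((ξ : F) ^ (n * (n + 1)) + ((ξ : F) ^ (n * (n + 1)))⁻¹)
      (((ξ : F) ^ (n * (n + 1))) ^ (2 * n + 1 + 1)) P.rep := by
  have e1 : (2 * n + 1 + 1) / 2 = n + 1 := by omega
  refine inv_of_mem_orbit hq (odd_two_mul_add_one n) _ ?_ hP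
  rw [add_inv_generator_quarter hq hξ]
  refine ⟨?_, ?_, ?_⟩
  · simp [dt]
  · have h := generator_pow_half hq hξ
    simp only [hm, e1, Matrix.cons_val, ← pow_mul]
    have e2 : (n + 1) * (2 * n + 1) = 2 * n * (n + 1) + (n + 1) := by ring
    rw [e2, pow_add, h]
    simp
  · simp only [dt, e1, Matrix.cons_val, ← pow_mul, Nat.add_sub_cancel]
    rw [mul_one, mul_zero, sub_zero, ← pow_mul]
    congr 1
    ring

theorem mem_H₂_iff (hq : Nat.card F = (2 * n + 1) ^ 2)
    (hξ : ∀ x : Fˣ, x ∈ Subgroup.zpowers ξ) (P : PG3 F) :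
    P ∈ H₂ hq ξ ↔ Inv (2 * n + 1) ((ξ : F) ^ (n * (n + 1)) + ((ξ : F) ^ (n * (n + 1)))⁻¹)
      (((ξ : F) ^ (n * (n + 1))) ^ (2 * n + 1 - 1)) P.rep := by
  have e1 : (2 * n + 1 + 1) / 2 = n + 1 := by omega
  have e3 : (2 * n + 1 - 1) / 2 = n := by omega
  have hn := pos_of_card hq
  constructor
  · intro hP
    refine inv_of_mem_orbit hq (odd_two_mul_add_one n) _ ?_ hP
    rw [add_inv_generator_quarter hq hξ]
    refine ⟨?_, ?_, ?_⟩
    · simp [dt]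
    · have h := generator_pow_half hq hξ
      simp only [hm, e3, Matrix.cons_val, ← pow_mul]
      have e2 : n * (2 * n + 1 + 1) = 2 * n * (n + 1) := by ring
      rw [e2, h]
      simp
    · simp only [dt, e1, e3, Matrix.cons_val, ← pow_mul]
      rw [Nat.add_sub_cancel, mul_one, mul_zero, zero_sub, mul_assoc,
        Even.neg_pow (even_two_mul _), ← pow_mul]
      congr 1
      ring
  · intro hP
    refine mem_orbit_of_inv hq (odd_two_mul_add_one n)
      (typeE_generator_pow hq hξ hn (by omega)) (add_inv_generator_quarter hq hξ) _ ?_ hP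
    rw [e3]
    exact exists_norm_neg_one hq hξ

end generator

end HermVeronese

/-! ### The three families. -/

open HermVeronese in
theorem mainTheorem5 {F : Type*} [Field F] [Finite F] (q : ℕ) (hodd : Odd q)
    (hq : Nat.card F = q ^ 2) (ξ : Fˣ) (hξ : ∀ x : Fˣ, x ∈ Subgroup.zpowers ξ) :
    (∀ j k : ℕ, 1 ≤ j → j ≤ q → j ≠ (q + 1) / 2 → 1 ≤ k → k ≤ q - 2 → k ≠ (q - 1) / 2 →
      HermVeronese.LinePattern q (HermVeronese.S q ξ j ∪ HermVeronese.E q ξ k)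
        (HermVeronese.S q ξ j \ HermVeronese.O F q) (HermVeronese.E q ξ k \ HermVeronese.O F q)
        (HermVeronese.O F q)) ∧
    (∀ k : ℕ, 1 ≤ k → k ≤ q - 2 → k ≠ (q - 1) / 2 →
      HermVeronese.LinePattern q (HermVeronese.H₁ hq ξ ∪ HermVeronese.E q ξ k)
        (HermVeronese.H₁ hq ξ) (HermVeronese.E q ξ k \ HermVeronese.O F q)
        (HermVeronese.O F q)) ∧
    (∀ j : ℕ, 1 ≤ j → j ≤ q → j ≠ (q + 1) / 2 →
      HermVeronese.LinePattern q (HermVeronese.S q ξ j ∪ HermVeronese.H₂ hq ξ)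
        (HermVeronese.S q ξ j \ HermVeronese.O F q) (HermVeronese.H₂ hq ξ)
        (HermVeronese.O F q)) := by
  obtain ⟨n, rfl⟩ := hodd
  have hodd := odd_two_mul_add_one n
  have hn := pos_of_card hq
  have hS (j : ℕ) (h1 : 1 ≤ j) (h2 : j ≤ 2 * n + 1) (h3 : j ≠ (2 * n + 1 + 1) / 2) :
      TypeS (2 * n + 1) ((ξ : F) ^ (j * n)) ∧
        (ξ : F) ^ (j * n) + ((ξ : F) ^ (j * n))⁻¹ ≠ 0 ∧ O F (2 * n + 1) ⊆ S (2 * n + 1) ξ j ∧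
        ∀ P, P ∈ S (2 * n + 1) ξ j \ O F (2 * n + 1) ↔
          Inv (2 * n + 1) ((ξ : F) ^ (j * n) + ((ξ : F) ^ (j * n))⁻¹)
            (((ξ : F) ^ (j * n)) ^ (2 * n + 1 + 1)) P.rep := by
    have hT := typeS_generator_pow hq hξ h1 h2
    have h0 := add_inv_ne_zero (generator_pow_ne_of_ne_half hq hξ h1 h2 (by omega)) hT.ne_zero
    rw [S_eq]
    exact ⟨hT, h0, O_subset_surface hq _,
      mem_surface_diff_O_iff hq h0 hT.1 (hT.pow_add_inv hq)⟩
  have hE (k : ℕ) (h1 : 1 ≤ k) (h2 : k ≤ 2 * n + 1 - 2) (h3 : k ≠ (2 * n + 1 - 1) / 2) :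
      TypeE (2 * n + 1) ((ξ : F) ^ (k * (n + 1))) ∧
        (ξ : F) ^ (k * (n + 1)) + ((ξ : F) ^ (k * (n + 1)))⁻¹ ≠ 0 ∧
        O F (2 * n + 1) ⊆ E (2 * n + 1) ξ k ∧
        ∀ P, P ∈ E (2 * n + 1) ξ k \ O F (2 * n + 1) ↔
          Inv (2 * n + 1) ((ξ : F) ^ (k * (n + 1)) + ((ξ : F) ^ (k * (n + 1)))⁻¹)
            (((ξ : F) ^ (k * (n + 1))) ^ (2 * n + 1 - 1)) P.rep := by
    have hT := typeE_generator_pow hq hξ h1 (by omega)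
    have h0 := add_inv_ne_zero
      (generator_pow_ne_of_ne_half' hq hξ h1 (by omega) (by omega)) hT.2.2
    rw [E_eq]
    exact ⟨hT, h0, O_subset_surface hq _,
      mem_surface_diff_O_iff hq h0 hT.1 (hT.pow_add_inv hq)⟩
  refine ⟨?_, ?_, ?_⟩
  · intro j k j1 j2 j3 k1 k2 k3
    obtain ⟨hT, h0, hO, hmem⟩ := hS j j1 j2 j3
    obtain ⟨hT', -, hO', hmem'⟩ := hE k k1 k2 k3
    refine linePattern_of hq hodd hT hT' (Or.inl h0) ?_ (fun P => (hmem P).1) hmem'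
    ext P
    have hP : P ∈ O F (2 * n + 1) → P ∈ S (2 * n + 1) ξ j := fun h => hO h
    simp only [Set.mem_union, Set.mem_sdiff]
    tauto
  · intro k k1 k2 k3
    obtain ⟨hT', h0, hO', hmem'⟩ := hE k k1 k2 k3
    -- H₁ takes the omitted index j = (q+1)/2, where γ = 0.
    have hT := typeS_generator_pow hq hξ (j := n + 1) (by omega) (by omega)
    rw [mul_comm (n + 1) n] at hT
    refine linePattern_of hq hodd hT hT' (Or.inr h0) ?_ (fun P => inv_of_mem_H₁ hq hξ) hmem'
    rw [Set.union_comm (O F _), Set.union_assoc, Set.union_sdiff_cancel hO']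
  · intro j j1 j2 j3
    obtain ⟨hT, h0, hO, hmem⟩ := hS j j1 j2 j3
    -- H₂ takes the omitted index k = (q-1)/2.
    have hT' := typeE_generator_pow hq hξ (k := n) (by omega) (by omega)
    refine linePattern_of hq hodd hT hT' (Or.inl h0) ?_ (fun P => (hmem P).1)
      (mem_H₂_iff hq hξ)
    rw [Set.union_sdiff_cancel hO]
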